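/- **Conventions.** All logarithms have base $2$ unless a base is shown. A string of length $n$ over an alphabet of size $\sigma$ is a string $s=s[1]\cdots s[n]$ in which exactly $\sigma$ distinct letters occur, the letters being integers from $[0..n]$. An LZ77 parsing of $s$ is a factorization $s=f_1f_2\cdots f_r$ into non-empty phrases such that each $f_i$ is either a single letter, or $|f_i|>1$ and $f_i$ without its last letter has an occurrence in $s$ starting at some position $j\in[1..|f_1\cdots f_{i-1}|]$ (the occurrence may overlap $f_i$). The greedy LZ77 parsing chooses, from left to right, each $f_i$ as long as possible. A phrase $f_i$ is represented by a triple $\langle d,\ell,c\rangle$, where $\ell=|f_i|$, $c$ is the last letter of $f_i$, and $d=0$ if $|f_i|=1$, while otherwise $d=|f_1\cdots f_{i-1}|-j$ for some $j$ as above. Let $e_d,e_\ell,e_c$ be three encoders, that is, maps from the non-negative integers to bit strings such that every positive integer $x$ is mapped to a bit string of length $\Theta(\log(x+1))$. An LZ77 encoding of $s$ corresponding to a parsing is the concatenation of the strings $e_d(d)e_\ell(\ell)e_c(c)$ over triples $\langle d,\ell,c\rangle$ representing its phrases. Let $\mathsf{LZ_{gr}}(s)$ and $\mathsf{LZ_{opt}}(s)$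 be the minimal sizes in bits of, respectively, an LZ77 encoding corresponding to the greedy parsing of $s$ and an arbitrary LZ77 encoding of $s$. **Theorem.** There are absolute constants $\alpha,\beta>0$ such that, for any fixed encoders $e_d,e_\ell,e_c$ as above, the following holds. (1) There is a constant $\gamma>0$ (depending only on the encoders) such that, for all integers $n>1$, $\sigma\in[2..n]$ and $z$ with $\sigma\le z\le \frac{n}{\log_\sigma n}$, there is a string $s$ of length $n$ over an alphabet of size $\sigma$ for which the number $z'$ of phrases in the greedy LZ77 parsing satisfies $\alpha z\le z'\le\beta z$ and $$\frac{\mathsf{LZ_{gr}}(s)}{\mathsf{LZ_{opt}}(s)}\ \ge\ \gamma\cdot\min\Big\{z,\ \frac{\log n}{\log\log_\sigma z+\log\sigma}\Big\}.$$ (2) In particular, on every constant alphabet the upper bound $O(\min\{z',\frac{\log n}{\log\log_\sigma z'}\})$ on $\mathsf{LZ_{gr}}/\mathsf{LZ_{opt}}$ in terms of the number $z'$ of phrases of the greedy parsing is attained: for every $\sigma\ge2$ there is a constant $\gamma_\sigma>0$ (depending only on $\sigma$ and the encoders) such that, for all integers $n>1$ and $z$ with $n\ge\sigma$ and $\sigma\le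 z\le\frac{n}{\log_\sigma n}$, there is a string $s$ of length $n$ over an alphabet of size $\sigma$ whose greedy LZ77 parsing has $z'\in[\alpha z,\beta z]$ phrases and $$\frac{\mathsf{LZ_{gr}}(s)}{\mathsf{LZ_{opt}}(s)}\ \ge\ \gamma_\sigma\cdot\min\Big\{z',\ \frac{\log n}{\log\log_\sigma z'}\Big\},$$ where the quotient is read as $+\infty$ if $\log\log_\sigma z'=0$. -/

import Mathlib

namespace LZ77

/-- `s` is a string of length `n` whose alphabet is a set of exactly `σ` integers
from `[0..n]`, each of which occurs in `s`. -/
def IsString (n σ : ℕ) (s : List ℕ) : Prop :=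
  s.length = n ∧ (∀ x ∈ s, x ≤ n) ∧ s.toFinset.card = σ

/-- The string `u` has an occurrence in `s` starting at the (1-based) position `j ∈ [1..p]`. -/
def EarlierOcc (s : List ℕ) (p : ℕ) (u : List ℕ) (j : ℕ) : Prop :=
  1 ≤ j ∧ j ≤ p ∧ u <+: s.drop (j - 1)

/-- `f` is an admissible phrase of `s` directly after the prefix of `s` of length `p`:
a non-empty substring starting there that is a letter, or whose part without the last letter
has an earlier occurrence (which may overlap `f`). -/
def IsPhrase (s : List ℕ) (p : ℕ) (f : List ℕ) : Prop :=
  f ≠ [] ∧ f <+: s.drop p ∧ (f.length = 1 ∨ (1 < f.length ∧ ∃ j, EarlierOcc s p f.dropLast j))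

/-- The total length of the first `i` phrases. -/
def start (P : List (List ℕ)) (i : ℕ) : ℕ := (P.take i).flatten.length

/-- `P` is the list of phrases of an LZ77 parsing of `s`. -/
def IsParsing (s : List ℕ) (P : List (List ℕ)) : Prop :=
  P.flatten = s ∧ ∀ (i : ℕ) (h : i < P.length), IsPhrase s (start P i) P[i]

/-- The LZ77 parsing in which each phrase is the longest admissible one at its position. -/
def IsGreedyParsing (s : List ℕ) (P : List (List ℕ)) : Prop :=
  IsParsing s P ∧
    ∀ (i : ℕ) (h : i < P.length) (g : List ℕ),
      IsPhrase s (start P i) g → g.length ≤ P[i].length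

/-- A triple `⟨d, ℓ, c⟩`. -/
structure Triple where
  d : ℕ
  len : ℕ
  c : ℕ

/-- The triple `t` represents the phrase `f` placed directly after the prefix of length `p`. -/
def Represents (s : List ℕ) (p : ℕ) (f : List ℕ) (t : Triple) : Prop :=
  t.len = f.length ∧ f.getLast? = some t.c ∧
    ((f.length = 1 ∧ t.d = 0) ∨
      (1 < f.length ∧ ∃ j, EarlierOcc s p f.dropLast j ∧ t.d = p - j))

/-- An encoder maps each positive integer `x` to a bit string of length `Θ(log (x + 1))`. -/
def IsLogEncoder (e : ℕ → List Bool) : Prop :=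
  ∃ a b : ℝ, 0 < a ∧ 0 < b ∧ ∀ x : ℕ, 0 < x →
    a * Real.logb 2 ((x : ℝ) + 1) ≤ ((e x).length : ℝ) ∧
      ((e x).length : ℝ) ≤ b * Real.logb 2 ((x : ℝ) + 1)

/-- The bit string of a list of triples. -/
def encode (ed el ec : ℕ → List Bool) (T : List Triple) : List Bool :=
  (T.map fun t => ed t.d ++ el t.len ++ ec t.c).flatten

/-- `w` is an LZ77 encoding corresponding to the parsing `P` of `s`. -/
def IsEncoding (ed el ec : ℕ → List Bool) (s : List ℕ) (P : List (List ℕ)) (w : List Bool) :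
    Prop :=
  ∃ T : List Triple, T.length = P.length ∧
    (∀ (i : ℕ) (hP : i < P.length) (hT : i < T.length), Represents s (start P i) P[i] T[i]) ∧
    w = encode ed el ec T

/-- The sizes in bits of all greedy LZ77 encodings of `s`. -/
def greedySizes (ed el ec : ℕ → List Bool) (s : List ℕ) : Set ℕ :=
  {b | ∃ P w, IsGreedyParsing s P ∧ IsEncoding ed el ec s P w ∧ w.length = b}

/-- The sizes in bits of all LZ77 encodings of `s`. -/
def allSizes (ed el ec : ℕ → List Bool) (s : List ℕ) : Set ℕ :=
  {b | ∃ P w, IsParsing s P ∧ IsEncoding ed el ec s P w ∧ w.length = b}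

/-- `min {z, log n / log log_σ z}`, where the quotient counts as `+∞` if its denominator is `0`
(the denominator is non-negative for `z ≥ σ ≥ 2`). -/
noncomputable def upperBound (n σ z : ℕ) : ℝ :=
  if 0 < Real.logb 2 (Real.logb σ z) then
    min (z : ℝ) (Real.logb 2 n / Real.logb 2 (Real.logb σ z))
  else z

end LZ77

namespace LZ77

/-! ### Phrases in terms of positions -/

/-! The greedy parsing maximises phrase length and so may be forced to copy from far away, while
another parsing with about as many phrases copies from nearby. In `hardWord` the letters 0, …, σ − 1
are followed by N left blocks, a run of G ones, a 0, and N right blocks. Block i spells the k Gray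
code digits of i between the marker 001 and a final letter, which is 0 on the left and 1 on the
right; the ones between the digits keep 00 from recurring inside a block. Hence right block i
without its last letter has a single earlier occurrence, in left block i (`occurrence_of_block`),
and the copy stops there because the final letters differ (`start_succ_right`). The run of ones
makes a greedy phrase begin at the first right block (`isCut_right_zero`). So greedy has N phrases
of distance at least G ≥ n/2, which cost Ω(N log n) bits.

Consecutive blocks differ in at most one letter (`exists_block_mismatch`), so two phrases copied
from the preceding block produce a block (`Parsable.blocks`). Their distances and lengths are at
most 2k + 4 = O(log_σ z), so with A = log log_σ z + log σ the whole string costs O(zA + log n) bits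
(`parsable_hardWord`). For N of order z the quotient is Ω(min {z, log n / A}). The cheap parsing
also shows that greedy has O(z) phrases, since greedy minimises their number
(`IsGreedyParsing.length_le`).

If n ≤ 1024σ, the minimum is bounded and only the number of phrases matters (`easyWord`). For part
(2), z' is proportional to z and the term log σ goes into the constant. -/

/-- The factor of `s` at the positions `[p, q)`. -/
def seg (s : List ℕ) (p q : ℕ) : List ℕ := (s.drop p).take (q - p)

/-- The factor at `[p, q)` without its last letter also occurs at position `j`. -/
def Matches (s : List ℕ) (j p q : ℕ) : Prop := ∀ t, p + t + 1 < q → s[j + t]? = s[p + t]?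

/-- The factor at `[p, q)` is an admissible phrase. -/
def Adm (s : List ℕ) (p q : ℕ) : Prop :=
  p < q ∧ q ≤ s.length ∧ (q = p + 1 ∨ ∃ j, j < p ∧ Matches s j p q)

theorem length_seg {s : List ℕ} {p q : ℕ} (hq : q ≤ s.length) : (seg s p q).length = q - p := by
  simp [seg]; omega

theorem seg_append_drop (s : List ℕ) {p q : ℕ} (h : p ≤ q) :
    seg s p q ++ s.drop q = s.drop p := by
  have : s.drop q = (s.drop p).drop (q - p) := by rw [List.drop_drop]; congr 1; omega
  rw [seg, this, List.take_append_drop]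

theorem eq_seg_of_prefix {s f : List ℕ} {p : ℕ} (h : f <+: s.drop p) :
    f = seg s p (p + f.length) := by
  rw [seg, Nat.add_sub_cancel_left]; exact List.prefix_iff_eq_take.1 h

/-- Passage from the 1-based position j + 1 to the 0-based position j. -/
theorem earlierOcc_seg_iff {s : List ℕ} {p q j : ℕ} (hq : q ≤ s.length) :
    EarlierOcc s p (seg s p q).dropLast (j + 1) ↔ j < p ∧ Matches s j p q := by
  unfold EarlierOcc Matches
  rw [List.prefix_iff_getElem?]
  constructor
  · rintro ⟨-, h1, h2⟩
    refine ⟨h1, fun t ht => ?_⟩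
    have := h2 t (by rw [List.length_dropLast, length_seg hq]; omega)
    simp [seg, List.getElem?_drop] at this
    rw [this, List.getElem?_eq_getElem]
  · rintro ⟨h1, h2⟩
    refine ⟨by omega, h1, fun t ht => ?_⟩
    rw [List.length_dropLast, length_seg hq] at ht
    have := h2 t (by omega)
    simp [seg, List.getElem?_drop]
    rw [this, List.getElem?_eq_getElem]

theorem isPhrase_seg_iff {s : List ℕ} {p q : ℕ} (hq : q ≤ s.length) :
    IsPhrase s p (seg s p q) ↔ Adm s p q := by
  have hl := length_seg (p := p) hq
  unfold IsPhrase Adm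
  constructor
  · rintro ⟨h0, -, h⟩
    have : 0 < (seg s p q).length := List.length_pos_iff.2 h0
    refine ⟨by omega, hq, ?_⟩
    rcases h with h | ⟨-, j, hj⟩
    · left; omega
    · right
      obtain ⟨j, rfl⟩ : ∃ i, j = i + 1 := ⟨j - 1, by have := hj.1; omega⟩
      exact ⟨j, (earlierOcc_seg_iff hq).1 hj⟩
  · rintro ⟨h0, -, h⟩
    have h3 : 0 < (seg s p q).length := by omega
    refine ⟨List.length_pos_iff.1 h3, List.take_prefix _ _, ?_⟩
    by_cases h1 : q = p + 1
    · left; omega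
    · right
      have h2 : 1 < (seg s p q).length := by omega
      obtain ⟨j, hj⟩ := h.resolve_left h1
      exact ⟨h2, j + 1, (earlierOcc_seg_iff hq).2 hj⟩

theorem IsPhrase.adm {s f : List ℕ} {p : ℕ} (h : IsPhrase s p f) : Adm s p (p + f.length) := by
  have h2 := h.2.1.length_le
  have h3 : 0 < f.length := List.length_pos_iff.2 h.1
  rw [List.length_drop] at h2
  rw [eq_seg_of_prefix h.2.1] at h
  exact (isPhrase_seg_iff (by omega)).1 h

/-- A right part of an admissible phrase is admissible. -/
theorem Adm.mono_left {s : List ℕ} {p p' q : ℕ} (h : Adm s p q) (hp : p ≤ p') (hq : p' < q) :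
    Adm s p' q := by
  obtain ⟨h0, h1, h2⟩ := h
  refine ⟨hq, h1, ?_⟩
  rcases h2 with h2 | ⟨j, hj, hm⟩
  · left; omega
  · right
    refine ⟨j + (p' - p), by omega, fun t ht => ?_⟩
    have := hm (p' - p + t) (by omega)
    rw [show j + (p' - p) + t = j + (p' - p + t) by omega, this]
    congr 1; omega

theorem getLast?_seg {s : List ℕ} {p q : ℕ} (h : p < q) (hq : q ≤ s.length) :
    (seg s p q).getLast? = s[q - 1]? := by
  rw [List.getLast?_eq_getElem?, length_seg hq]
  simp only [seg, List.getElem?_take, List.getElem?_drop]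
  rw [if_pos (by omega)]; congr 1; omega

theorem represents_single {s : List ℕ} {p c : ℕ} (h : s[p]? = some c) :
    Represents s p (seg s p (p + 1)) ⟨0, 1, c⟩ := by
  have hp : p < s.length := by
    by_contra hh; rw [List.getElem?_eq_none (by omega)] at h; cases h
  refine ⟨?_, ?_, Or.inl ⟨?_, rfl⟩⟩
  · simp [length_seg (p := p) (q := p + 1) hp]
  · rw [getLast?_seg (by omega) hp]; simpa using h
  · simp [length_seg (p := p) (q := p + 1) hp]

theorem represents_copy {s : List ℕ} {j p q c : ℕ} (hq : p + 1 < q) (hj : j < p)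
    (hm : Matches s j p q) (h : s[q - 1]? = some c) :
    Represents s p (seg s p q) ⟨p - (j + 1), q - p, c⟩ := by
  have hs : q - 1 < s.length := by
    by_contra hh; rw [List.getElem?_eq_none (by omega)] at h; cases h
  have hqs : q ≤ s.length := by omega
  refine ⟨(length_seg hqs).symm, ?_, Or.inr ⟨?_, j + 1, (earlierOcc_seg_iff hqs).2 ⟨hj, hm⟩, rfl⟩⟩
  · rw [getLast?_seg (by omega) hqs]; exact h
  · rw [length_seg hqs]; omega

/-- A phrase given by its positions has a representation. -/
theorem Adm.exists_represents {s : List ℕ} {p q : ℕ} (h : Adm s p q) :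
    ∃ t, Represents s p (seg s p q) t := by
  obtain ⟨h0, h1, h2⟩ := h
  have hc : s[q - 1]? = some (s[q - 1]'(by omega)) := List.getElem?_eq_getElem (by omega)
  by_cases h3 : q = p + 1
  · subst h3; exact ⟨_, represents_single hc⟩
  · obtain ⟨j, hj, hm⟩ := h2.resolve_left h3
    exact ⟨_, represents_copy (by omega) hj hm hc⟩

/-- The distance in a representation of a long phrase comes from an earlier occurrence. -/
theorem Represents.exists_matches {s : List ℕ} {p q : ℕ} {t : Triple} (hq : q ≤ s.length)
    (hpq : p + 1 < q) (h : Represents s p (seg s p q) t) :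
    ∃ j, j < p ∧ Matches s j p q ∧ t.d = p - (j + 1) := by
  obtain ⟨-, -, h | ⟨-, j, hj, hd⟩⟩ := h
  · rw [length_seg hq] at h; omega
  · obtain ⟨j, rfl⟩ : ∃ i, j = i + 1 := ⟨j - 1, by have := hj.1; omega⟩
    obtain ⟨h1, h2⟩ := (earlierOcc_seg_iff hq).1 hj
    exact ⟨j, h1, h2, hd⟩

/-! ### Building parsings from right to left -/

/-- The phrases `P` starting at position `p`, together with the triples `T`, satisfy `Φ`. -/
def Chain (Φ : ℕ → List ℕ → Triple → Prop) (p : ℕ) (P : List (List ℕ)) (T : List Triple) : Prop :=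
  T.length = P.length ∧
    ∀ (i : ℕ) (hP : i < P.length) (hT : i < T.length), Φ (p + start P i) P[i] T[i]

theorem start_zero (P : List (List ℕ)) : start P 0 = 0 := rfl

theorem start_cons_succ (f : List ℕ) (P : List (List ℕ)) (i : ℕ) :
    start (f :: P) (i + 1) = f.length + start P i := by simp [start]

theorem start_succ (P : List (List ℕ)) {i : ℕ} (h : i < P.length) :
    start P (i + 1) = start P i + P[i].length := by
  simp only [start]
  rw [List.take_succ_eq_append_getElem h, List.flatten_append, List.length_append]
  simp only [List.flatten_cons, List.flatten_nil, List.append_nil]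

theorem Chain.nil (Φ : ℕ → List ℕ → Triple → Prop) (p : ℕ) : Chain Φ p [] [] :=
  ⟨rfl, fun i h => by simp at h⟩

theorem Chain.cons {Φ : ℕ → List ℕ → Triple → Prop} {p : ℕ} {P : List (List ℕ)} {T : List Triple}
    {f : List ℕ} {t : Triple} (h : Φ p f t) (hc : Chain Φ (p + f.length) P T) :
    Chain Φ p (f :: P) (t :: T) := by
  refine ⟨by simp [hc.1], ?_⟩
  intro i hP hT
  cases i with
  | zero => simpa [start_zero] using h
  | succ i =>
    have := hc.2 i (by simpa using hP) (by simpa using hT)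
    rw [start_cons_succ, ← add_assoc]
    simpa using this

/-- The number of bits of a triple. -/
def bits (ed el ec : ℕ → List Bool) (t : Triple) : ℕ :=
  (ed t.d).length + (el t.len).length + (ec t.c).length

theorem length_encode (ed el ec : ℕ → List Bool) (T : List Triple) :
    (encode ed el ec T).length = (T.map (bits ed el ec)).sum := by
  rw [encode, List.length_flatten, List.map_map]
  congr 1
  exact List.map_congr_left fun t _ => by simp [bits, add_assoc]

/-- The suffix of `s` from position `p` on can be parsed with at most `m` phrases
and encoded with at most `b` bits. -/
def Parsable (ed el ec : ℕ → List Bool) (s : List ℕ) (p m b : ℕ) : Prop :=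
  ∃ P T, P.flatten = s.drop p ∧
    Chain (fun p f t => IsPhrase s p f ∧ Represents s p f t) p P T ∧
    P.length ≤ m ∧ (T.map (bits ed el ec)).sum ≤ b

/-! ### Cheap parsings by copying from a fixed short distance -/

section Parsable
variable {ed el ec : ℕ → List Bool} {s : List ℕ} {p q m b : ℕ}

theorem Parsable.nil : Parsable ed el ec s s.length 0 0 :=
  ⟨[], [], by simp, Chain.nil _ _, le_rfl, le_rfl⟩

theorem Parsable.cons {t : Triple} {B : ℕ} (h : Adm s p q)
    (hr : Represents s p (seg s p q) t) (hB : bits ed el ec t ≤ B)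
    (hc : Parsable ed el ec s q m b) : Parsable ed el ec s p (m + 1) (b + B) := by
  obtain ⟨P, T, h1, h2, h3, h4⟩ := hc
  refine ⟨seg s p q :: P, t :: T, ?_, ?_, by simpa using h3, ?_⟩
  · rw [List.flatten_cons, h1, seg_append_drop s h.1.le]
  · refine Chain.cons ⟨(isPhrase_seg_iff h.2.1).2 h, hr⟩ ?_
    rw [length_seg h.2.1, Nat.add_sub_cancel' h.1.le]; exact h2
  · simp; omega

theorem Parsable.mono {m' b' : ℕ} (hm : m ≤ m') (hb : b ≤ b')
    (h : Parsable ed el ec s p m b) : Parsable ed el ec s p m' b' := by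
  obtain ⟨P, T, h1, h2, h3, h4⟩ := h
  exact ⟨P, T, h1, h2, by omega, by omega⟩

/-- Triples with small distance, length and letter have at most `B` bits. -/
def CheapTriples (ed el ec : ℕ → List Bool) (L σ B : ℕ) : Prop :=
  ∀ d l c, d < L → 1 ≤ l → l ≤ L → c < σ → bits ed el ec ⟨d, l, c⟩ ≤ B

variable {L σ B : ℕ}

theorem Parsable.single (hB : CheapTriples ed el ec L σ B) (hL : 0 < L) {c : ℕ}
    (hc : s[p]? = some c) (hcσ : c < σ) (h : Parsable ed el ec s (p + 1) m b) :
    Parsable ed el ec s p (m + 1) (b + B) := by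
  have hp : p < s.length := by
    by_contra hh; rw [List.getElem?_eq_none (by omega)] at hc; cases hc
  exact h.cons ⟨by omega, hp, Or.inl rfl⟩ (represents_single hc) (hB _ _ _ hL le_rfl hL hcσ)

theorem Parsable.singles (hB : CheapTriples ed el ec L σ B) (hL : 0 < L)
    (hs : ∀ x ∈ s, x < σ) (w : ℕ) (hw : p + w ≤ s.length)
    (h : Parsable ed el ec s (p + w) m b) : Parsable ed el ec s p (m + w) (b + w * B) := by
  induction w generalizing p with
  | zero => simpa using h
  | succ w ih =>
    have h1 := ih (p := p + 1) (by omega) (by rwa [add_assoc, add_comm 1])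
    have hp : p < s.length := by omega
    have := h1.single hB hL (List.getElem?_eq_getElem hp) (hs _ (List.getElem_mem hp))
    rwa [add_one_mul, ← add_assoc, ← add_assoc]

theorem Parsable.copy (hB : CheapTriples ed el ec L σ B) (hs : ∀ x ∈ s, x < σ)
    (hL : L ≤ p) (hL0 : 0 < L) (hpq : p < q) (hqL : q ≤ p + L) (hq : q ≤ s.length)
    (hm : Matches s (p - L) p q) (h : Parsable ed el ec s q m b) :
    Parsable ed el ec s p (m + 1) (b + B) := by
  have hc : s[q - 1]? = some (s[q - 1]'(by omega)) := List.getElem?_eq_getElem (by omega)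
  by_cases h1 : q = p + 1
  · subst h1
    exact h.single hB hL0 hc (hs _ (List.getElem_mem _))
  · exact h.cons ⟨hpq, hq, Or.inr ⟨_, by omega, hm⟩⟩ (represents_copy (by omega) (by omega) hm hc)
      (hB _ _ _ (by omega) (by omega) (by omega) (hs _ (List.getElem_mem _)))

/-- A block that differs from the preceding one in at most one position takes two phrases. -/
theorem Parsable.block (hB : CheapTriples ed el ec L σ B) (hs : ∀ x ∈ s, x < σ)
    (hL : L ≤ p) (hL0 : 0 < L) (hq : p + L ≤ s.length) {e : ℕ}
    (he : ∀ r, r < L → r ≠ e → s[p - L + r]? = s[p + r]?)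
    (h : Parsable ed el ec s (p + L) m b) : Parsable ed el ec s p (m + 2) (b + 2 * B) := by
  -- The last letter of a phrase need not match its source: the first phrase ends at the mismatch e,
  -- the second at the end of the block. If e is the last offset or lies beyond it, one phrase is
  -- enough.
  by_cases heL : e + 1 < L
  · have h1 : Parsable ed el ec s (p + e + 1) (m + 1) (b + B) := by
      refine h.copy hB hs (by omega) hL0 (by omega) (by omega) hq fun t ht => ?_
      have := he (e + 1 + t) (by omega) (by omega)
      convert this using 2 <;> omega
    have := h1.copy hB hs hL hL0 (q := p + e + 1) (by omega) (by omega) (by omega)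
      fun t ht => he t (by omega) (by omega)
    convert this using 1
    ring
  · have := h.copy hB hs hL hL0 (by omega) le_rfl hq fun t ht => he t (by omega) (by omega)
    exact this.mono (by omega) (by omega)

/-- The first block has no predecessor and is spelled letter by letter, which accounts for L; each
later block takes two phrases. -/
theorem Parsable.blocks (hB : CheapTriples ed el ec L σ B) (hs : ∀ x ∈ s, x < σ)
    (hL0 : 0 < L) {N : ℕ} (hN : 0 < N) (hq : p + N * L ≤ s.length)
    (he : ∀ i, i + 1 < N → ∃ e, ∀ r, r < L → r ≠ e →
      s[p + i * L + r]? = s[p + (i + 1) * L + r]?)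
    (h : Parsable ed el ec s (p + N * L) m b) :
    Parsable ed el ec s p (m + (2 * N + L)) (b + (2 * N + L) * B) := by
  -- Here w counts the blocks at the right end already parsed; w < N leaves out the first block.
  have key : ∀ w, w < N →
      Parsable ed el ec s (p + (N - w) * L) (m + 2 * w) (b + 2 * w * B) := by
    intro w
    induction w with
    | zero => intro _; simpa using h
    | succ w ih =>
      intro hw
      have h1 := ih (by omega)
      obtain ⟨i, hi⟩ : ∃ i, N - (w + 1) = i + 1 := ⟨N - (w + 1) - 1, by omega⟩
      have hi2 : N - w = i + 2 := by omega
      rw [hi2] at h1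
      rw [hi]
      obtain ⟨e, he⟩ := he i (by omega)
      have hle : (i + 2) * L ≤ N * L := Nat.mul_le_mul_right _ (by omega)
      have e1 : (i + 1) * L = i * L + L := by ring
      have e2 : (i + 2) * L = i * L + L + L := by ring
      have h2 : Parsable ed el ec s (p + (i + 1) * L + L) (m + 2 * w) (b + 2 * w * B) := by
        convert h1 using 1; omega
      have := h2.block hB hs (by omega) hL0 (by omega) (e := e) fun r hr hre => by
        have := he r hr hre
        rw [← this]; congr 1; omega
      rwa [mul_add_one 2 w, add_mul _ _ B, ← add_assoc, ← add_assoc]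
  have h1 := key (N - 1) (by omega)
  rw [show N - (N - 1) = 1 by omega, one_mul] at h1
  have hle : 1 * L ≤ N * L := Nat.mul_le_mul_right _ hN
  refine (h1.singles hB hL0 hs L (by omega)).mono (by omega) ?_
  have : 2 * (N - 1) * B ≤ 2 * N * B := Nat.mul_le_mul_right _ (by omega)
  have e3 : (2 * N + L) * B = 2 * N * B + L * B := by ring
  omega

end Parsable

theorem Parsable.exists_parsing {ed el ec : ℕ → List Bool} {s : List ℕ} {m b : ℕ}
    (h : Parsable ed el ec s 0 m b) :
    ∃ P, IsParsing s P ∧ P.length ≤ m ∧ ∃ w, IsEncoding ed el ec s P w ∧ w.length ≤ b := by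
  obtain ⟨P, T, h1, ⟨h2, h2'⟩, h3, h4⟩ := h
  refine ⟨P, ⟨by simpa using h1, fun i hi => ?_⟩, h3, encode ed el ec T, ⟨T, h2, ?_, rfl⟩, ?_⟩
  · simpa using (h2' i hi (by omega)).1
  · intro i hP hT; simpa using (h2' i hP hT).2
  · rwa [length_encode]

/-! ### The greedy parsing -/

theorem exists_greedy_chain (s : List ℕ) (p : ℕ) (hp : p ≤ s.length) :
    ∃ P T, P.flatten = s.drop p ∧
      Chain (fun p f t => (IsPhrase s p f ∧ ∀ g, IsPhrase s p g → g.length ≤ f.length) ∧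
        Represents s p f t) p P T := by
  induction hd : s.length - p using Nat.strong_induction_on generalizing p with
  | _ d ih =>
    rcases hp.eq_or_lt with rfl | hlt
    · exact ⟨[], [], by simp, Chain.nil _ _⟩
    classical
    have hS : ((Finset.range (s.length + 1)).filter (Adm s p)).Nonempty :=
      ⟨p + 1, by simp only [Finset.mem_filter, Finset.mem_range]
                 exact ⟨by omega, by omega, hlt, Or.inl rfl⟩⟩
    obtain ⟨q, hq, hmax⟩ := Finset.exists_max_image _ id hS
    simp only [Finset.mem_filter, Finset.mem_range, id] at hq hmax
    obtain ⟨t, ht⟩ := hq.2.exists_represents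
    have hpq := hq.2.1
    obtain ⟨P, T, h1, h2⟩ := ih (s.length - q) (by omega) q (by omega) rfl
    refine ⟨seg s p q :: P, t :: T, ?_, ?_⟩
    · rw [List.flatten_cons, h1, seg_append_drop s hpq.le]
    · refine Chain.cons ⟨⟨(isPhrase_seg_iff hq.2.2.1).2 hq.2, fun g hg => ?_⟩, ht⟩ ?_
      · have h3 := hg.adm
        have := hmax _ ⟨by have := h3.2.1; omega, h3⟩
        rw [length_seg hq.2.2.1]; omega
      · rw [length_seg hq.2.2.1, Nat.add_sub_cancel' hpq.le]; exact h2

theorem exists_greedy (ed el ec : ℕ → List Bool) (s : List ℕ) :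
    ∃ P w, IsGreedyParsing s P ∧ IsEncoding ed el ec s P w := by
  obtain ⟨P, T, h1, h2, h3⟩ := exists_greedy_chain s 0 (by omega)
  refine ⟨P, encode ed el ec T, ⟨⟨by simpa using h1, fun i hi => ?_⟩, fun i hi g hg => ?_⟩,
    T, h2, fun i hP hT => ?_, rfl⟩
  · simpa using (h3 i hi (by omega)).1.1
  · exact (h3 i hi (by omega)).1.2 g (by simpa using hg)
  · simpa using (h3 i hP hT).2

theorem start_le_length {s : List ℕ} {P : List (List ℕ)} (h : IsParsing s P) (i : ℕ) :
    start P i ≤ s.length := by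
  rw [← h.1, start]
  exact ((List.take_sublist i P).flatten).length_le

theorem start_of_length_le {s : List ℕ} {P : List (List ℕ)} (h : IsParsing s P) {i : ℕ}
    (hi : P.length ≤ i) : start P i = s.length := by
  rw [← h.1, start, List.take_of_length_le hi]

theorem IsParsing.adm {s : List ℕ} {P : List (List ℕ)} (h : IsParsing s P) {i : ℕ}
    (hi : i < P.length) : Adm s (start P i) (start P (i + 1)) := by
  rw [start_succ P hi]
  exact (h.2 i hi).adm

theorem IsGreedyParsing.le_start_succ {s : List ℕ} {P : List (List ℕ)} (h : IsGreedyParsing s P)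
    {i q : ℕ} (hi : i < P.length) (hq : Adm s (start P i) q) : q ≤ start P (i + 1) := by
  have := h.2 i hi _ ((isPhrase_seg_iff hq.2.1).2 hq)
  rw [length_seg hq.2.1] at this
  rw [start_succ P hi]; omega

/-- The greedy parsing is ahead of every other parsing. -/
theorem IsGreedyParsing.start_le {s : List ℕ} {P Q : List (List ℕ)} (h : IsGreedyParsing s P)
    (hQ : IsParsing s Q) (i : ℕ) : start Q i ≤ start P i := by
  induction i with
  | zero => simp [start_zero]
  | succ i ih =>
    by_cases hP : P.length ≤ i + 1
    · rw [start_of_length_le h.1 hP]; exact start_le_length hQ _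
    by_cases hle : start Q (i + 1) ≤ start P i
    · have := (h.1.adm (i := i) (by omega)).1
      omega
    by_cases hQi : i < Q.length
    -- The phrase of Q, cut down to begin where the greedy phrase begins, stays admissible, so the
    -- greedy phrase reaches at least as far.
    · exact h.le_start_succ (by omega) ((hQ.adm hQi).mono_left ih (by omega))
    · have h1 := start_of_length_le hQ (i := i) (by omega)
      have h2 := start_le_length hQ (i + 1)
      omega

theorem IsParsing.start_lt {s : List ℕ} {P : List (List ℕ)} (h : IsParsing s P) {i : ℕ}
    (hi : i < P.length) : start P i < s.length :=
  (h.adm hi).1.trans_le (h.adm hi).2.1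

/-- The greedy parsing has the least number of phrases. -/
theorem IsGreedyParsing.length_le {s : List ℕ} {P Q : List (List ℕ)} (h : IsGreedyParsing s P)
    (hQ : IsParsing s Q) : P.length ≤ Q.length := by
  by_contra hlt
  have h1 := h.start_le hQ Q.length
  rw [start_of_length_le hQ le_rfl] at h1
  have := h.1.start_lt (i := Q.length) (by omega)
  omega

theorem IsParsing.exists_index {s : List ℕ} {P : List (List ℕ)} (h : IsParsing s P) {x : ℕ}
    (hx : x < s.length) : ∃ i, i < P.length ∧ start P i ≤ x ∧ x < start P (i + 1) := by
  have hex : ∃ i, x < start P i := ⟨P.length, by rwa [start_of_length_le h le_rfl]⟩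
  classical
  have h1 := Nat.find_spec hex
  obtain ⟨i, hi⟩ : ∃ i, Nat.find hex = i + 1 := by
    refine ⟨Nat.find hex - 1, ?_⟩
    have : Nat.find hex ≠ 0 := by
      intro h0; rw [h0, start_zero] at h1; omega
    omega
  have h2 := Nat.find_min hex (m := i) (by omega)
  rw [hi] at h1
  refine ⟨i, ?_, by omega, h1⟩
  by_contra hlt
  have := start_of_length_le h (i := i) (by omega)
  omega

/-- The position `p` is the beginning of a phrase of `P`. -/
def IsCut (P : List (List ℕ)) (p : ℕ) : Prop := ∃ i, i < P.length ∧ start P i = p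

theorem IsParsing.isCut_succ {s : List ℕ} {P : List (List ℕ)} (h : IsParsing s P) {i : ℕ}
    (hi : start P (i + 1) < s.length) : IsCut P (start P (i + 1)) := by
  refine ⟨i + 1, ?_, rfl⟩
  by_contra hlt
  have := start_of_length_le h (i := i + 1) (by omega)
  omega

theorem IsGreedyParsing.start_succ_eq {s : List ℕ} {P : List (List ℕ)}
    (h : IsGreedyParsing s P) {i q : ℕ} (hi : i < P.length)
    (hq : Adm s (start P i) q) (hq' : ∀ r, Adm s (start P i) r → r ≤ q) :
    start P (i + 1) = q :=
  le_antisymm (hq' _ (h.1.adm hi)) (h.le_start_succ hi hq)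

theorem card_le_length {P : List (List ℕ)} {ι : Type*} (S : Finset ι) (g : ι → ℕ)
    (hg : Set.InjOn g S) (h : ∀ x ∈ S, IsCut P (g x)) : S.card ≤ P.length := by
  classical
  choose! f hf hf' using h
  have := Finset.card_le_card_of_injOn (t := Finset.range P.length) f
    (fun x hx => by simpa using hf x hx)
    (fun x hx y hy hxy => hg hx hy (by rw [← hf' x hx, ← hf' y hy, hxy]))
  simpa using this

/-- If all phrases beginning at the positions `g x` are expensive, then so is the encoding. -/
theorem card_mul_le_length_encode {ed el ec : ℕ → List Bool} {P : List (List ℕ)}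
    {T : List Triple} (hT : T.length = P.length) {ι : Type*} (S : Finset ι) (g : ι → ℕ)
    (hg : Set.InjOn g S) (h : ∀ x ∈ S, IsCut P (g x)) (B : ℝ)
    (hB : ∀ x ∈ S, ∀ i, ∀ hi : i < T.length, start P i = g x → B ≤ bits ed el ec T[i]) :
    S.card * B ≤ (encode ed el ec T).length := by
  classical
  choose! f hf hf' using h
  have hinj : Set.InjOn f S :=
    fun x hx y hy hxy => hg hx hy (by rw [← hf' x hx, ← hf' y hy, hxy])
  rw [length_encode]
  -- Writing the list sum over indices allows dropping terms; the default 0 is never used below the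
  -- length.
  have e1 : (T.map (bits ed el ec)).sum
      = ∑ i ∈ Finset.range T.length, ((T.map (bits ed el ec))[i]?).getD 0 := by
    rw [← List.length_map (bits ed el ec), ← Fin.sum_univ_getElem, Finset.sum_range]
    refine Finset.sum_congr rfl fun i _ => ?_
    rw [List.getElem?_eq_getElem i.2, Option.getD_some]
  rw [e1]
  push_cast
  calc (S.card : ℝ) * B = ∑ x ∈ S, B := by simp
    _ ≤ ∑ x ∈ S, ((((T.map (bits ed el ec))[f x]?).getD 0 : ℕ) : ℝ) := by
        refine Finset.sum_le_sum fun x hx => ?_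
        have hi : f x < T.length := by rw [hT]; exact hf x hx
        have := hB x hx (f x) hi (hf' x hx)
        simpa [hi] using this
    _ = ∑ i ∈ S.image f, ((((T.map (bits ed el ec))[i]?).getD 0 : ℕ) : ℝ) := by
        rw [Finset.sum_image hinj]
    _ ≤ _ := by
        refine Finset.sum_le_sum_of_subset_of_nonneg ?_ fun _ _ _ => by positivity
        intro i hi
        obtain ⟨x, hx, rfl⟩ := Finset.mem_image.1 hi
        rw [Finset.mem_range, hT]; exact hf x hx

theorem exists_isLeast_sizes (ed el ec : ℕ → List Bool) (s : List ℕ) :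
    ∃ gr opt, IsLeast (greedySizes ed el ec s) gr ∧ IsLeast (allSizes ed el ec s) opt ∧
      opt ≤ gr := by
  obtain ⟨P, w, h1, h2⟩ := exists_greedy ed el ec s
  have hsub : greedySizes ed el ec s ⊆ allSizes ed el ec s := by
    rintro b ⟨P, w, h1, h2, h3⟩; exact ⟨P, w, h1.1, h2, h3⟩
  have hg : (greedySizes ed el ec s).Nonempty := ⟨_, P, w, h1, h2, rfl⟩
  have hl : ∀ S : Set ℕ, S.Nonempty → IsLeast S (sInf S) :=
    fun S hS => ⟨Nat.sInf_mem hS, fun _ hx => Nat.sInf_le hx⟩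
  have h3 := hl _ hg
  have h4 := hl _ (hg.mono hsub)
  exact ⟨_, _, h3, h4, h4.2 (hsub h3.1)⟩

/-! ### Modular Gray code -/

/-- The digit `t` of the number `i` in the modular Gray code of base `σ`. -/
def grayDigit (σ i t : ℕ) : ℕ := (i / σ ^ t - i / σ ^ (t + 1)) % σ

theorem grayDigit_zero (σ i : ℕ) : grayDigit σ i 0 = (i - i / σ) % σ := by simp [grayDigit]

theorem grayDigit_succ (σ i t : ℕ) : grayDigit σ i (t + 1) = grayDigit σ (i / σ) t := by
  simp only [grayDigit, Nat.div_div_eq_div_mul]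
  rw [← pow_succ', ← pow_succ']

theorem grayDigit_lt {σ : ℕ} (hσ : 0 < σ) (i t : ℕ) : grayDigit σ i t < σ := Nat.mod_lt _ hσ

/-- The digits from 1 on are those of i / σ and determine it by induction; digit 0 then gives i
modulo σ. -/
theorem grayDigit_injective {σ : ℕ} (k : ℕ) {i j : ℕ} (hi : i < σ ^ k)
    (hj : j < σ ^ k) (h : ∀ t, t < k → grayDigit σ i t = grayDigit σ j t) : i = j := by
  induction k generalizing i j with
  | zero => simp at hi hj; omega
  | succ k ih =>
    have hq : i / σ = j / σ := by
      refine ih ?_ ?_ fun t ht => ?_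
      · exact Nat.div_lt_of_lt_mul (by rwa [← pow_succ'])
      · exact Nat.div_lt_of_lt_mul (by rwa [← pow_succ'])
      · have := h (t + 1) (by omega)
        rwa [grayDigit_succ, grayDigit_succ] at this
    have h0 := h 0 (by omega)
    rw [grayDigit_zero, grayDigit_zero, ← hq] at h0
    have h1 : i / σ ≤ i := Nat.div_le_self _ _
    have h2 : i / σ ≤ j := by rw [hq]; exact Nat.div_le_self _ _
    have h3 : i ≡ j [MOD σ] := by
      have := Nat.ModEq.add_right (i / σ) (show i - i / σ ≡ j - i / σ [MOD σ] from h0)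
      rwa [Nat.sub_add_cancel h1, Nat.sub_add_cancel h2] at this
    rw [← Nat.div_add_mod i σ, ← Nat.div_add_mod j σ, hq, h3]

/-- Consecutive numbers differ in at most one digit of the Gray code. -/
theorem grayDigit_succ_number {σ : ℕ} (hσ : 2 ≤ σ) (i : ℕ) :
    ∃ e, ∀ t, t ≠ e → grayDigit σ i t = grayDigit σ (i + 1) t := by
  induction i using Nat.strong_induction_on with
  | _ i ih =>
    -- With a carry, i and i / σ both grow by 1, so digit 0 is unchanged and the mismatch is that of
    -- the quotients. Without a carry only digit 0 changes.
    by_cases hd : σ ∣ i + 1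
    · have hdiv : (i + 1) / σ = i / σ + 1 := by rw [Nat.succ_div, if_pos hd]
      have hi : i / σ < i := by
        refine Nat.div_lt_self ?_ hσ
        have := Nat.le_of_dvd (by omega) hd
        omega
      obtain ⟨e, he⟩ := ih _ hi
      refine ⟨e + 1, fun t ht => ?_⟩
      cases t with
      | zero => rw [grayDigit_zero, grayDigit_zero, hdiv]; congr 1; omega
      | succ t => rw [grayDigit_succ, grayDigit_succ, hdiv]; exact he t (by omega)
    · have hdiv : (i + 1) / σ = i / σ := by rw [Nat.succ_div, if_neg hd, add_zero]
      refine ⟨0, fun t ht => ?_⟩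
      obtain ⟨t, rfl⟩ : ∃ u, t = u + 1 := ⟨t - 1, by omega⟩
      rw [grayDigit_succ, grayDigit_succ, hdiv]

/-! ### The string -/

/-- The letter number `r` of the block `0 0 1 d₀ 1 d₁ ⋯ 1 dₖ₋₁ 1 x`, where the `dₜ` are the digits
of `i` in the Gray code. -/
def blockLetter (σ k i x r : ℕ) : ℕ :=
  if r < 2 then 0 else if r % 2 = 0 then 1 else if r = 2 * k + 3 then x
  else grayDigit σ i ((r - 3) / 2)

/-- The letters of the string consisting of all letters `0, …, σ - 1`, the `N` blocks with final
letter `0`, the run `1 ⋯ 1` of length `G`, the letter `0`, and the `N` blocks with final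
letter `1`. -/
def letter (σ k N G x : ℕ) : ℕ :=
  if x < σ then x
  else if x < σ + N * (2 * k + 4) then
    blockLetter σ k ((x - σ) / (2 * k + 4)) 0 ((x - σ) % (2 * k + 4))
  else if x < σ + N * (2 * k + 4) + G then 1
  else if x = σ + N * (2 * k + 4) + G then 0
  else blockLetter σ k ((x - (σ + N * (2 * k + 4) + G + 1)) / (2 * k + 4)) 1
    ((x - (σ + N * (2 * k + 4) + G + 1)) % (2 * k + 4))

/-- The string with the given letters. -/
def word (n : ℕ) (F : ℕ → ℕ) : List ℕ := (List.range n).map F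

theorem length_word (n : ℕ) (F : ℕ → ℕ) : (word n F).length = n := by simp [word]

theorem word_getElem? {n : ℕ} (F : ℕ → ℕ) {x : ℕ} (hx : x < n) :
    (word n F)[x]? = some (F x) := by simp [word, hx]

theorem matches_word_iff {n : ℕ} {F : ℕ → ℕ} {j p q : ℕ} (hj : j ≤ p) (hq : q ≤ n) :
    Matches (word n F) j p q ↔ ∀ t, p + t + 1 < q → F (j + t) = F (p + t) := by
  refine forall₂_congr fun t ht => ?_
  rw [word_getElem? F (by omega), word_getElem? F (by omega), Option.some_inj]

theorem isString_word {n σ : ℕ} {F : ℕ → ℕ} (hσ : σ ≤ n) (h1 : ∀ x, x < σ → F x = x)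
    (h2 : ∀ x, x < n → F x < σ) : IsString n σ (word n F) := by
  refine ⟨length_word _ _, ?_, ?_⟩
  · intro x hx
    simp only [word, List.mem_map, List.mem_range] at hx
    obtain ⟨y, hy, rfl⟩ := hx
    have := h2 y hy
    omega
  · have : (word n F).toFinset = Finset.range σ := by
      ext x
      simp only [word, List.mem_toFinset, List.mem_map, List.mem_range, Finset.mem_range]
      constructor
      · rintro ⟨y, hy, rfl⟩; exact h2 y hy
      · intro hx; exact ⟨x, by omega, h1 x hx⟩
    rw [this, Finset.card_range]

/-! ### Letters of the string and the positions of its blocks -/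

section
variable {σ k N G : ℕ}

theorem block_pos_lt {L i r : ℕ} (hi : i < N) (hr : r < L) : i * L + r < N * L := by
  have : (i + 1) * L ≤ N * L := Nat.mul_le_mul_right _ hi
  rw [add_one_mul] at this
  omega

theorem letter_prefix {x : ℕ} (hx : x < σ) : letter σ k N G x = x := by
  simp [letter, hx]

theorem letter_left {i r : ℕ} (hi : i < N) (hr : r < 2 * k + 4) :
    letter σ k N G (σ + i * (2 * k + 4) + r) = blockLetter σ k i 0 r := by
  have h := block_pos_lt hi hr
  have e : σ + i * (2 * k + 4) + r - σ = r + (2 * k + 4) * i := by rw [mul_comm i]; omega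
  rw [letter, if_neg (by omega), if_pos (by omega), e, Nat.add_mul_div_left _ _ (by omega),
    Nat.add_mul_mod_self_left, Nat.mod_eq_of_lt hr, Nat.div_eq_of_lt hr, zero_add]

theorem letter_gap {x : ℕ} (h1 : σ + N * (2 * k + 4) ≤ x) (h2 : x < σ + N * (2 * k + 4) + G) :
    letter σ k N G x = 1 := by
  rw [letter, if_neg (by have := Nat.zero_le (N * (2 * k + 4)); omega), if_neg (by omega),
    if_pos h2]

theorem letter_separator : letter σ k N G (σ + N * (2 * k + 4) + G) = 0 := by
  rw [letter, if_neg (by have := Nat.zero_le (N * (2 * k + 4)); omega), if_neg (by omega),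
    if_neg (by omega), if_pos rfl]

theorem letter_right {i r : ℕ} (hr : r < 2 * k + 4) :
    letter σ k N G (σ + N * (2 * k + 4) + G + 1 + i * (2 * k + 4) + r) = blockLetter σ k i 1 r := by
  have h := Nat.zero_le (N * (2 * k + 4))
  have h' := Nat.zero_le (i * (2 * k + 4))
  have e : σ + N * (2 * k + 4) + G + 1 + i * (2 * k + 4) + r - (σ + N * (2 * k + 4) + G + 1)
      = r + (2 * k + 4) * i := by rw [mul_comm i]; omega
  rw [letter, if_neg (by omega), if_neg (by omega), if_neg (by omega), if_neg (by omega), e,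
    Nat.add_mul_div_left _ _ (by omega),
    Nat.add_mul_mod_self_left, Nat.mod_eq_of_lt hr, Nat.div_eq_of_lt hr, zero_add]

theorem exists_block_pos {L y : ℕ} (hL : 0 < L) (h : y < N * L) :
    ∃ i r, i < N ∧ r < L ∧ y = i * L + r :=
  ⟨y / L, y % L, Nat.div_lt_of_lt_mul (by rwa [mul_comm]), Nat.mod_lt _ hL,
    by rw [mul_comm, Nat.div_add_mod]⟩

/-- The five zones of the string. -/
theorem position_cases {x : ℕ} (hx : x < σ + N * (2 * k + 4) + G + 1 + N * (2 * k + 4)) :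
    x < σ ∨ (∃ i r, i < N ∧ r < 2 * k + 4 ∧ x = σ + i * (2 * k + 4) + r) ∨
    (σ + N * (2 * k + 4) ≤ x ∧ x < σ + N * (2 * k + 4) + G) ∨ x = σ + N * (2 * k + 4) + G ∨
    (∃ i r, i < N ∧ r < 2 * k + 4 ∧
      x = σ + N * (2 * k + 4) + G + 1 + i * (2 * k + 4) + r) := by
  by_cases h1 : x < σ
  · exact Or.inl h1
  by_cases h2 : x < σ + N * (2 * k + 4)
  · obtain ⟨i, r, hi, hr, h⟩ := exists_block_pos (L := 2 * k + 4) (y := x - σ) (N := N)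
      (by omega) (by omega)
    exact Or.inr (Or.inl ⟨i, r, hi, hr, by omega⟩)
  by_cases h3 : x < σ + N * (2 * k + 4) + G
  · exact Or.inr (Or.inr (Or.inl ⟨by omega, h3⟩))
  by_cases h4 : x = σ + N * (2 * k + 4) + G
  · exact Or.inr (Or.inr (Or.inr (Or.inl h4)))
  · obtain ⟨i, r, hi, hr, h⟩ := exists_block_pos (L := 2 * k + 4)
      (y := x - (σ + N * (2 * k + 4) + G + 1)) (N := N) (by omega) (by omega)
    exact Or.inr (Or.inr (Or.inr (Or.inr ⟨i, r, hi, hr, by omega⟩)))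

theorem blockLetter_lt (hσ : 2 ≤ σ) {i x r : ℕ} (hx : x < 2) : blockLetter σ k i x r < σ := by
  unfold blockLetter
  split_ifs
  · omega
  · omega
  · omega
  · exact grayDigit_lt (by omega) _ _

theorem letter_lt (hσ : 2 ≤ σ) {x : ℕ} : letter σ k N G x < σ := by
  unfold letter
  split_ifs
  · assumption
  · exact blockLetter_lt hσ (by omega)
  · omega
  · omega
  · exact blockLetter_lt hσ (by omega)

theorem blockLetter_of_lt_two {i x r : ℕ} (h : r < 2) : blockLetter σ k i x r = 0 := by
  simp [blockLetter, h]

theorem blockLetter_even {i x r : ℕ} (h : 2 ≤ r) (h2 : r % 2 = 0) :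
    blockLetter σ k i x r = 1 := by
  rw [blockLetter, if_neg (by omega), if_pos h2]

theorem blockLetter_last {i x : ℕ} : blockLetter σ k i x (2 * k + 3) = x := by
  rw [blockLetter, if_neg (by omega), if_neg (by omega), if_pos rfl]

theorem blockLetter_digit {i x t : ℕ} (ht : t < k) :
    blockLetter σ k i x (2 * t + 3) = grayDigit σ i t := by
  rw [blockLetter, if_neg (by omega), if_neg (by omega), if_neg (by omega)]
  congr 1; omega

theorem blockLetter_eq_of_ne_last {i x x' r : ℕ} (h : r ≠ 2 * k + 3) :
    blockLetter σ k i x r = blockLetter σ k i x' r := by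
  simp [blockLetter, h]

/-- Inside a block, `0 0 1` occurs only at the beginning. -/
theorem eq_zero_of_marker {i x r : ℕ} (h0 : blockLetter σ k i x r = 0) (h1 : blockLetter σ k i x (r + 1) = 0) : r = 0 := by
  by_contra hne
  rcases Nat.mod_two_eq_zero_or_one r with h | h
  · rw [blockLetter_even (by omega) h] at h0; omega
  · rw [blockLetter_even (by omega) (by omega)] at h1; omega

/-- The factor `0 0 1` marks the beginnings of the blocks. -/
theorem marker (hσ : 2 ≤ σ) {j : ℕ} (hj : j + 2 < σ + N * (2 * k + 4) + G + 1 + N * (2 * k + 4))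
    (hG : 2 ≤ G) (h0 : letter σ k N G j = 0) (h1 : letter σ k N G (j + 1) = 0)
    (h2 : letter σ k N G (j + 2) = 1) :
    ∃ i, i < N ∧ (j = σ + i * (2 * k + 4) ∨
      j = σ + N * (2 * k + 4) + G + 1 + i * (2 * k + 4)) := by
  rcases position_cases (σ := σ) (k := k) (N := N) (G := G) (x := j) (by omega) with h | ⟨i, r, hi, hr, rfl⟩ | ⟨ha, hb⟩ | rfl |
    ⟨i, r, hi, hr, rfl⟩
  · rw [letter_prefix h] at h0
    subst h0
    rw [letter_prefix (by omega)] at h1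
    omega
  · refine ⟨i, hi, Or.inl ?_⟩
    rw [letter_left hi hr] at h0
    by_cases hr1 : r + 1 < 2 * k + 4
    · rw [add_assoc, letter_left hi hr1] at h1
      have := eq_zero_of_marker h0 h1
      omega
    -- A final 0 is followed by the 00 of the next block, which gives 000, or by the run of ones,
    -- which gives 01.
    · exfalso
      obtain rfl : r = 2 * k + 3 := by omega
      by_cases hi1 : i + 1 < N
      · have e : σ + i * (2 * k + 4) + (2 * k + 3) + 2 = σ + (i + 1) * (2 * k + 4) + 1 := by ring
        rw [e, letter_left hi1 (by omega), blockLetter_of_lt_two (by omega)] at h2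
        omega
      · obtain rfl : N = i + 1 := by omega
        rw [letter_gap (by rw [add_one_mul]; omega) (by rw [add_one_mul]; omega)] at h1
        omega
  · rw [letter_gap ha hb] at h0; omega
  · exfalso
    by_cases hN : 0 < N
    · have := letter_right (σ := σ) (k := k) (N := N) (G := G) (i := 0) (r := 1) (by omega)
      rw [zero_mul, add_zero, blockLetter_of_lt_two (by omega)] at this
      exact absurd (this.symm.trans h2) (by omega)
    · obtain rfl : N = 0 := by omega
      omega
  · refine ⟨i, hi, Or.inr ?_⟩
    rw [letter_right hr] at h0
    by_cases hr1 : r + 1 < 2 * k + 4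
    · rw [add_assoc, letter_right hr1] at h1
      have := eq_zero_of_marker h0 h1
      omega
    · exfalso
      obtain rfl : r = 2 * k + 3 := by omega
      have h := block_pos_lt (N := N) hi hr
      by_cases hi1 : i + 1 < N
      · have e : σ + N * (2 * k + 4) + G + 1 + i * (2 * k + 4) + (2 * k + 3) + 2
          = σ + N * (2 * k + 4) + G + 1 + (i + 1) * (2 * k + 4) + 1 := by ring
        rw [e, letter_right (by omega), blockLetter_of_lt_two (by omega)] at h2
        omega
      · obtain rfl : N = i + 1 := by omega
        have := add_one_mul i (2 * k + 4)
        omega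

/-- The number of a block is determined by the block without its last letter. -/
theorem block_injective {i i' x x' : ℕ} (hi : i < σ ^ k) (hi' : i' < σ ^ k)
    (h : ∀ r, r < 2 * k + 3 → blockLetter σ k i x r = blockLetter σ k i' x' r) : i = i' := by
  refine grayDigit_injective k hi hi' fun t ht => ?_
  have := h (2 * t + 3) (by omega)
  rwa [blockLetter_digit ht, blockLetter_digit ht] at this

/-- An earlier occurrence of a right block without its last letter is the left block. -/
theorem occurrence_of_block (hσ : 2 ≤ σ) (hG : 2 ≤ G) (hN : N ≤ σ ^ k) {i j : ℕ} (hi : i < N)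
    (hj : j < σ + N * (2 * k + 4) + G + 1 + i * (2 * k + 4))
    (h : ∀ r, r < 2 * k + 3 → letter σ k N G (j + r) = blockLetter σ k i 1 r) :
    j = σ + i * (2 * k + 4) := by
  have hlt := block_pos_lt (N := N) (L := 2 * k + 4) hi (r := 2 * k + 3) (by omega)
  obtain ⟨i', hi', hj' | hj'⟩ := marker (σ := σ) (k := k) (N := N) (G := G) (j := j) hσ
    (by omega) hG
    (by have := h 0 (by omega); rwa [blockLetter_of_lt_two (by omega)] at this)
    (by have := h 1 (by omega); rwa [blockLetter_of_lt_two (by omega)] at this)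
    (by have := h 2 (by omega); rwa [blockLetter_even (by omega) (by omega)] at this)
  · have : i' = i := by
      refine block_injective (σ := σ) (k := k) (x := 0) (x' := 1) (by omega) (by omega)
        fun r hr => ?_
      rw [← h r hr, hj', letter_left hi' (by omega)]
    rw [hj', this]
  · have : i' = i := by
      refine block_injective (σ := σ) (k := k) (x := 1) (x' := 1) (by omega) (by omega)
        fun r hr => ?_
      rw [← h r hr, hj', letter_right (by omega)]
    -- Right block i itself does not begin before its own position.
    rw [this] at hj'; omega

/-- No long run of ones begins before the gap. -/
theorem exists_ne_one (hσ : 2 ≤ σ) (hN : 0 < N) {j : ℕ} (hj : j < σ + N * (2 * k + 4)) :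
    ∃ r, r < 2 * k + 4 ∧ letter σ k N G (j + r) ≠ 1 := by
  by_cases h : j < σ
  · by_cases h1 : j = 1
    · subst h1
      refine ⟨1, by omega, ?_⟩
      by_cases h2 : 2 < σ
      · rw [letter_prefix (by omega)]; omega
      · obtain rfl : σ = 2 := by omega
        have := letter_left (σ := 2) (k := k) (G := G) hN (r := 0) (by omega)
        rw [zero_mul, blockLetter_of_lt_two (by omega)] at this
        simp only [add_zero] at this
        show letter 2 k N G 2 ≠ 1
        omega
    · exact ⟨0, by omega, by rw [add_zero, letter_prefix h]; exact h1⟩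
  · obtain ⟨i, r, hi, hr, h'⟩ := exists_block_pos (L := 2 * k + 4) (y := j - σ) (N := N)
      (by omega) (by omega)
    -- Every left block ends with the letter 0.
    refine ⟨2 * k + 3 - r, by omega, ?_⟩
    have e : j + (2 * k + 3 - r) = σ + i * (2 * k + 4) + (2 * k + 3) := by omega
    rw [e, letter_left hi (by omega), blockLetter_last]
    omega

theorem exists_block_mismatch (hσ : 2 ≤ σ) (i x : ℕ) :
    ∃ e, ∀ r, r ≠ e → blockLetter σ k i x r = blockLetter σ k (i + 1) x r := by
  obtain ⟨e, he⟩ := grayDigit_succ_number hσ i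
  -- Digit t of the Gray code stands at offset 2t + 3 of the block.
  refine ⟨2 * e + 3, fun r hr => ?_⟩
  unfold blockLetter
  split_ifs
  · rfl
  · rfl
  · rfl
  · exact he _ (by omega)

end

/-- The string for which the greedy parsing is expensive. -/
def hardWord (σ k N G : ℕ) : List ℕ :=
  word (σ + N * (2 * k + 4) + G + 1 + N * (2 * k + 4)) (letter σ k N G)

/-! ### Greedy and cheap parsings of the hard string -/

section
variable {σ k N G : ℕ} {P : List (List ℕ)}

theorem length_hardWord :
    (hardWord σ k N G).length = σ + N * (2 * k + 4) + G + 1 + N * (2 * k + 4) :=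
  length_word _ _

theorem isString_hardWord (hσ : 2 ≤ σ) :
    IsString (σ + N * (2 * k + 4) + G + 1 + N * (2 * k + 4)) σ (hardWord σ k N G) :=
  isString_word (by rw [add_assoc, add_assoc, add_assoc]; omega) (fun _ hx => letter_prefix hx)
    fun _ _ => letter_lt hσ

/-- The greedy parsing has a phrase beginning with the first right block. -/
theorem isCut_right_zero (hσ : 2 ≤ σ) (hN : 0 < N) (hG : 4 * k + 8 ≤ G)
    (hP : IsGreedyParsing (hardWord σ k N G) P) :
    IsCut P (σ + N * (2 * k + 4) + G + 1) := by
  have hlen := length_hardWord (σ := σ) (k := k) (N := N) (G := G)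
  have hNL : 0 < N * (2 * k + 4) := by positivity
  obtain ⟨i, hi, h1, h2⟩ := hP.1.exists_index (x := σ + N * (2 * k + 4)) (by omega)
  have hadm := hP.1.adm hi
  -- Otherwise the source would contain 2k + 4 ones in a row beginning before the run, against
  -- `exists_ne_one`.
  have hend : start P (i + 1) ≤ σ + N * (2 * k + 4) + (2 * k + 4) := by
    by_contra hgt
    have hq := hadm.2.1
    obtain h3 | ⟨j, hj, hm⟩ := hadm.2.2
    · omega
    rw [hardWord, matches_word_iff hj.le (by omega)] at hm
    obtain ⟨r, hr, hne⟩ := exists_ne_one (k := k) (G := G) hσ hN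
      (j := j + (σ + N * (2 * k + 4) - start P i)) (by omega)
    have := hm (σ + N * (2 * k + 4) - start P i + r) (by omega)
    rw [← add_assoc, ← add_assoc, Nat.add_sub_cancel' h1,
      letter_gap (x := σ + N * (2 * k + 4) + r) (by omega) (by omega)] at this
    exact hne this
  obtain ⟨i', hi', hp⟩ := hP.1.isCut_succ (i := i) (by omega)
  rw [← hp] at h2 hend
  -- The next phrase begins inside the run after at least one 1, so it copies ones from one position
  -- back and takes the separator as its free last letter.
  have hnext : start P (i' + 1) = σ + N * (2 * k + 4) + G + 1 := by
    refine hP.start_succ_eq hi' ⟨by omega, by omega, Or.inr ⟨start P i' - 1, by omega, ?_⟩⟩ ?_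
    · rw [hardWord, matches_word_iff (by omega) (by omega)]
      intro t ht
      rw [letter_gap (by omega) (by omega), letter_gap (by omega) (by omega)]
    · rintro q ⟨hq0, hq, hq2⟩
      by_contra hgt
      obtain h3 | ⟨j, hj, hm⟩ := hq2
      · omega
      rw [hardWord, matches_word_iff hj.le (by omega)] at hm
      -- A longer phrase would contain the separator in its copied part. At least 2k + 4 ones remain
      -- by the choice G ≥ 4k + 8, which excludes a source before the run; a source inside the run
      -- still reads 1 where the phrase reads 0.
      by_cases hjg : j < σ + N * (2 * k + 4)
      · obtain ⟨r, hr, hne⟩ := exists_ne_one (k := k) (G := G) hσ hN hjg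
        have := hm r (by omega)
        rw [letter_gap (x := start P i' + r) (by omega) (by omega)] at this
        exact hne this
      · have := hm (σ + N * (2 * k + 4) + G - start P i') (by omega)
        rw [Nat.add_sub_cancel' (by omega), letter_separator,
          letter_gap (by omega) (by omega)] at this
        omega
  rw [← hnext]
  exact hP.1.isCut_succ (by omega)

/-- The longest phrase beginning with a right block is this block. -/
theorem start_succ_right (hσ : 2 ≤ σ) (hG : 4 * k + 8 ≤ G) (hNk : N ≤ σ ^ k)
    (hP : IsGreedyParsing (hardWord σ k N G) P) {i m : ℕ} (hi : i < N) (hm : m < P.length)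
    (hs : start P m = σ + N * (2 * k + 4) + G + 1 + i * (2 * k + 4)) :
    start P (m + 1) = σ + N * (2 * k + 4) + G + 1 + i * (2 * k + 4) + (2 * k + 4) := by
  have hlen := length_hardWord (σ := σ) (k := k) (N := N) (G := G)
  have hlt := block_pos_lt (N := N) (L := 2 * k + 4) hi (r := 2 * k + 3) (by omega)
  apply hP.start_succ_eq hm <;> rw [hs]
  · refine ⟨by omega, by omega, Or.inr ⟨σ + i * (2 * k + 4), by omega, ?_⟩⟩
    rw [hardWord, matches_word_iff (by omega) (by omega)]
    intro t ht
    rw [letter_left hi (by omega), letter_right (by omega)]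
    exact blockLetter_eq_of_ne_last (by omega)
  · rintro q ⟨hq0, hq, hq2⟩
    by_contra hgt
    obtain h3 | ⟨j, hj, hmt⟩ := hq2
    · omega
    rw [hardWord, matches_word_iff hj.le (by omega)] at hmt
    have hje := occurrence_of_block hσ (by omega) hNk hi hj fun r hr => by
      rw [hmt r (by omega), letter_right (by omega)]
    -- A longer phrase would copy the final letter too, but its only possible source has 0 there
    -- instead of 1.
    have := hmt (2 * k + 3) (by omega)
    rw [hje, letter_left hi (by omega), letter_right (by omega), blockLetter_last,
      blockLetter_last] at this
    omega

/-- Once greedy is synchronised with the first right block, each phrase ends where the next block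
begins. -/
theorem isCut_right (hσ : 2 ≤ σ) (hG : 4 * k + 8 ≤ G) (hNk : N ≤ σ ^ k)
    (hP : IsGreedyParsing (hardWord σ k N G) P) {i : ℕ} (hi : i < N) :
    IsCut P (σ + N * (2 * k + 4) + G + 1 + i * (2 * k + 4)) := by
  induction i with
  | zero => simpa using isCut_right_zero hσ hi hG hP
  | succ i ih =>
    obtain ⟨m, hm, hs⟩ := ih (by omega)
    have h1 := start_succ_right hσ hG hNk hP (by omega) hm hs
    have e : σ + N * (2 * k + 4) + G + 1 + (i + 1) * (2 * k + 4)
      = σ + N * (2 * k + 4) + G + 1 + i * (2 * k + 4) + (2 * k + 4) := by ring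
    rw [e, ← h1]
    refine hP.1.isCut_succ ?_
    have hlen := length_hardWord (σ := σ) (k := k) (N := N) (G := G)
    have hlt := block_pos_lt (N := N) (L := 2 * k + 4) hi (r := 2 * k + 3) (by omega)
    omega

theorem right_injective (σ k N G : ℕ) :
    Function.Injective fun i => σ + N * (2 * k + 4) + G + 1 + i * (2 * k + 4) := by
  intro i j hij
  have : i * (2 * k + 4) = j * (2 * k + 4) := by simpa using hij
  exact Nat.eq_of_mul_eq_mul_right (by omega) this

theorem le_length_greedy (hσ : 2 ≤ σ) (hG : 4 * k + 8 ≤ G) (hNk : N ≤ σ ^ k)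
    (hP : IsGreedyParsing (hardWord σ k N G) P) : N ≤ P.length := by
  have := card_le_length (P := P) (Finset.range N) _ (right_injective σ k N G).injOn
    fun i hi => isCut_right hσ hG hNk hP (by simpa using hi)
  simpa using this

/-- The greedy parsing has `N` phrases whose distance is at least `G`. -/
theorem le_length_greedy_encoding {ed el ec : ℕ → List Bool} (hσ : 2 ≤ σ) (hG : 4 * k + 8 ≤ G)
    (hNk : N ≤ σ ^ k) (hP : IsGreedyParsing (hardWord σ k N G) P) {w : List Bool}
    (hw : IsEncoding ed el ec (hardWord σ k N G) P w) {B : ℝ}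
    (hB : ∀ d, G ≤ d → B ≤ (ed d).length) : N * B ≤ w.length := by
  obtain ⟨T, hT, hrep, rfl⟩ := hw
  have := card_mul_le_length_encode (ed := ed) (el := el) (ec := ec) hT (Finset.range N) _
    (right_injective σ k N G).injOn
    (fun i hi => isCut_right hσ hG hNk hP (by simpa using hi)) B ?_
  · simpa using this
  intro i hi m hm hs
  have hi : i < N := by simpa using hi
  have hmP : m < P.length := by omega
  have hsucc := start_succ_right hσ hG hNk hP hi hmP hs
  have hph := hP.1.2 m hmP
  have hr := hrep m hmP hm
  rw [eq_seg_of_prefix hph.2.1, ← start_succ P hmP, hsucc, hs] at hr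
  have hlen := length_hardWord (σ := σ) (k := k) (N := N) (G := G)
  have hlt := block_pos_lt (N := N) (L := 2 * k + 4) hi (r := 2 * k + 3) (by omega)
  obtain ⟨j, hj, hmt, hd⟩ := hr.exists_matches (by omega) (by omega)
  rw [hardWord, matches_word_iff hj.le (by omega)] at hmt
  have hje := occurrence_of_block hσ (by omega) hNk hi hj fun r hr => by
    rw [hmt r (by omega), letter_right (by omega)]
  -- The source is forced, so every representation has distance exactly N(2k + 4) + G.
  refine (hB _ (by omega : G ≤ T[m].d)).trans ?_
  have : (ed T[m].d).length ≤ bits ed el ec T[m] := by unfold bits; omega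
  exact_mod_cast this

/-- The string has a cheap parsing. -/
theorem parsable_hardWord {ed el ec : ℕ → List Bool} {B E : ℕ} (hσ : 2 ≤ σ) (hN : 0 < N)
    (hG : 2 ≤ G) (hB : CheapTriples ed el ec (2 * k + 4) σ B)
    (hE : bits ed el ec ⟨0, G, 0⟩ ≤ E) :
    Parsable ed el ec (hardWord σ k N G) 0 (σ + 2 * (2 * N + (2 * k + 4)) + 2)
      ((σ + 2 * (2 * N + (2 * k + 4)) + 1) * B + E) := by
  have hlen := length_hardWord (σ := σ) (k := k) (N := N) (G := G)
  have hs : ∀ x ∈ hardWord σ k N G, x < σ := by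
    intro x hx
    simp only [hardWord, word, List.mem_map] at hx
    obtain ⟨y, -, rfl⟩ := hx
    exact letter_lt hσ
  have h0 : Parsable ed el ec (hardWord σ k N G)
      (σ + N * (2 * k + 4) + G + 1 + N * (2 * k + 4)) 0 0 := by
    rw [← hlen]; exact Parsable.nil
  have h1 := h0.blocks hB hs (by omega) hN hlen.ge fun i hi => by
    obtain ⟨e, he⟩ := exists_block_mismatch (k := k) hσ i 1
    refine ⟨e, fun r hr hre => ?_⟩
    have hlt := block_pos_lt (N := N) (L := 2 * k + 4) hi hr
    have hlt' := block_pos_lt (N := N) (L := 2 * k + 4) (i := i) (by omega) hr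
    rw [hardWord, word_getElem? _ (by omega), word_getElem? _ (by omega), letter_right hr,
      letter_right hr, he r hre]
  have hz := word_getElem? (n := σ + N * (2 * k + 4) + G + 1 + N * (2 * k + 4))
    (letter σ k N G) (x := σ + N * (2 * k + 4) + G) (by omega)
  rw [letter_separator] at hz
  have hm : Matches (hardWord σ k N G) (σ + N * (2 * k + 4)) (σ + N * (2 * k + 4) + 1)
      (σ + N * (2 * k + 4) + G + 1) := by
    rw [hardWord, matches_word_iff (by omega) (by omega)]
    intro t ht
    rw [letter_gap (by omega) (by omega), letter_gap (by omega) (by omega)]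
  -- All ones of the run but the first, together with the separator, form one phrase of length G.
  -- Its source is one position back, which is recorded as distance 0.
  have h2 := h1.cons (p := σ + N * (2 * k + 4) + 1) (B := E)
    ⟨by omega, by omega, Or.inr ⟨_, by omega, hm⟩⟩
    (represents_copy (by omega) (by omega) hm hz) (by
      rw [Nat.sub_self, show σ + N * (2 * k + 4) + G + 1 - (σ + N * (2 * k + 4) + 1) = G by omega]
      exact hE)
  have h3 := h2.singles hB (by omega) hs 1 (by omega)
  have h4 := h3.blocks (p := σ) hB hs (by omega) hN (by omega) fun i hi => by
    obtain ⟨e, he⟩ := exists_block_mismatch (k := k) hσ i 0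
    refine ⟨e, fun r hr hre => ?_⟩
    have hlt := block_pos_lt (N := N) (L := 2 * k + 4) hi hr
    have hlt' := block_pos_lt (N := N) (L := 2 * k + 4) (i := i) (by omega) hr
    rw [hardWord, word_getElem? _ (by omega), word_getElem? _ (by omega), letter_left (by omega) hr,
      letter_left hi hr, he r hre]
  have h5 := Parsable.singles (p := 0) hB (by omega) hs σ (by omega) (by rwa [zero_add])
  refine h5.mono (by omega) (le_of_eq ?_)
  ring

end

/-! ### A string consisting mostly of distinct letters -/

/-- The string `0 1 ⋯ (σ - 1) 0 ⋯ 0` of length `n`. -/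
def easyWord (n σ : ℕ) : List ℕ := word n fun x => if x < σ then x else 0

theorem isString_easyWord {n σ : ℕ} (hσ : 0 < σ) (hn : σ ≤ n) :
    IsString n σ (easyWord n σ) :=
  isString_word hn (fun x hx => if_pos hx) fun x _ => by split_ifs <;> assumption

/-- Each of the first σ letters is new, so no phrase can begin with a copy of it, and every one of
these positions begins a phrase. -/
theorem le_length_greedy_easyWord {n σ : ℕ} (hn : σ ≤ n) {P : List (List ℕ)}
    (hP : IsParsing (easyWord n σ) P) : σ ≤ P.length := by
  have hlen : (easyWord n σ).length = n := length_word _ _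
  have key : ∀ x, x < σ → IsCut P x := by
    intro x
    induction x with
    | zero =>
      intro h0
      obtain ⟨i, hi, h1, h2⟩ := hP.exists_index (x := 0) (by omega)
      exact ⟨i, hi, by omega⟩
    | succ x ih =>
      intro hx
      obtain ⟨i, hi, h1⟩ := ih (by omega)
      have hadm := hP.adm hi
      have h2 : start P (i + 1) = x + 1 := by
        have hlt := hadm.1
        have hq := hadm.2.1
        obtain h3 | ⟨j, hj, hm⟩ := hadm.2.2
        · omega
        by_contra hne
        rw [easyWord, matches_word_iff hj.le (by omega)] at hm
        have := hm 0 (by omega)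
        rw [add_zero, add_zero, if_pos (by omega), if_pos (by omega)] at this
        omega
      rw [← h2]
      exact hP.isCut_succ (by omega)
  have := card_le_length (P := P) (Finset.range σ) id Function.injective_id.injOn
    fun i hi => key i (by simpa using hi)
  simpa using this

theorem IsParsing.length_le_length {s : List ℕ} {P : List (List ℕ)} (h : IsParsing s P) :
    P.length ≤ s.length := by
  have : ∀ i, i ≤ P.length → i ≤ start P i := by
    intro i
    induction i with
    | zero => intro _; omega
    | succ i ih =>
      intro hi
      have := (h.adm (i := i) (by omega)).1
      have := ih (by omega)
      omega
  have h1 := this P.length le_rfl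
  rwa [start_of_length_le h le_rfl] at h1

/-! ### Sizes of encodings -/

/-- Nothing is assumed about the length of the code of 0; since log (M + 1) ≥ 1, the constant
absorbs it. -/
theorem IsLogEncoder.exists_le {e : ℕ → List Bool} (he : IsLogEncoder e) :
    ∃ K : ℝ, 0 < K ∧ ∀ x M : ℕ, x ≤ M → 1 ≤ M →
      ((e x).length : ℝ) ≤ K * Real.logb 2 ((M : ℝ) + 1) := by
  obtain ⟨a, b, ha, hb, h⟩ := he
  refine ⟨b + (e 0).length, by positivity, fun x M hx hM => ?_⟩
  have hM' : (1 : ℝ) ≤ M := by exact_mod_cast hM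
  have h1 : 1 ≤ Real.logb 2 ((M : ℝ) + 1) := by
    rw [Real.le_logb_iff_rpow_le (by norm_num) (by positivity)]
    norm_num; linarith
  rcases Nat.eq_zero_or_pos x with rfl | hpos
  · have h2 : (0 : ℝ) ≤ (e 0).length := by positivity
    nlinarith
  · have h2 := (h x hpos).2
    have h3 : Real.logb 2 ((x : ℝ) + 1) ≤ Real.logb 2 ((M : ℝ) + 1) :=
      Real.logb_le_logb_of_le (by norm_num) (by positivity)
        (by have : (x : ℝ) ≤ M := by exact_mod_cast hx
            linarith)
    have h4 : (0 : ℝ) ≤ (e 0).length := by positivity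
    nlinarith

/-- The code of a phrase length is non-empty. This keeps the denominator of the ratio away from 0.
-/
theorem length_encoding_pos {ed el ec : ℕ → List Bool} (hel : IsLogEncoder el) {s : List ℕ}
    (hs : 0 < s.length) {P : List (List ℕ)} (hP : IsParsing s P) {w : List Bool}
    (hw : IsEncoding ed el ec s P w) : 0 < w.length := by
  obtain ⟨T, hT, hr, rfl⟩ := hw
  obtain ⟨i, hi, -, -⟩ := hP.exists_index hs
  have h1 := (hr i hi (by omega)).1
  have h2 : 0 < P[i].length := List.length_pos_iff.2 (hP.2 i hi).1
  obtain ⟨a, b, ha, -, h⟩ := hel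
  have h3 := (h P[i].length h2).1
  have h4 : 0 < Real.logb 2 ((P[i].length : ℝ) + 1) :=
    Real.logb_pos (by norm_num) (by
      have : (0 : ℝ) < P[i].length := by exact_mod_cast h2
      linarith)
  have h5 : (0 : ℝ) < (el P[i].length).length := lt_of_lt_of_le (by positivity) h3
  have h6 : 0 < (el P[i].length).length := by exact_mod_cast h5
  rw [length_encode]
  have h7 : bits ed el ec (T[i]'(by omega)) ≤ (T.map (bits ed el ec)).sum :=
    List.le_sum_of_mem (List.mem_map_of_mem (List.getElem_mem _))
  have h8 : 0 < bits ed el ec (T[i]'(by omega)) := by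
    unfold bits; rw [h1]; omega
  omega

/-! ### Estimates for logarithms -/

theorem one_le_logb_two {x : ℝ} (hx : 2 ≤ x) : 1 ≤ Real.logb 2 x := by
  rw [Real.le_logb_iff_rpow_le (by norm_num) (by linarith)]; simpa using hx

theorem logb_two_add_one_le {x : ℝ} (hx : 2 ≤ x) :
    Real.logb 2 (x + 1) ≤ 2 * Real.logb 2 x := by
  have : Real.logb 2 (x ^ 2) = 2 * Real.logb 2 x := by rw [Real.logb_pow]; norm_num
  rw [← this]
  exact Real.logb_le_logb_of_le (by norm_num) (by linarith) (by nlinarith)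

theorem logb_two_pow (k : ℕ) : Real.logb 2 ((2 : ℝ) ^ k) = k := by
  rw [Real.logb_pow, Real.logb_self_eq_one (by norm_num), mul_one]

/-- Split off 2 ^ 11 and use ln y ≤ y − 1 with ln 2 > 1/2. -/
theorem mul_logb_two_le {x : ℝ} (hx : 2048 ≤ x) : 128 * Real.logb 2 x ≤ x := by
  have h0 : x = 2 ^ 11 * (x / 2048) := by ring
  have h1 : Real.logb 2 x = 11 + Real.logb 2 (x / 2048) := by
    conv_lhs => rw [h0]
    rw [Real.logb_mul (by norm_num) (by positivity), logb_two_pow]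
    norm_num
  have h2 : Real.log (x / 2048) ≤ x / 2048 - 1 := Real.log_le_sub_one_of_pos (by positivity)
  have h3 : Real.logb 2 (x / 2048) ≤ 2 * (x / 2048 - 1) := by
    rw [Real.logb, div_le_iff₀ (Real.log_pos (by norm_num))]
    have := Real.log_two_gt_d9
    nlinarith
  rw [h1]; linarith

theorem logb_nat_le_logb_two {σ : ℕ} (hσ : 2 ≤ σ) {x : ℝ} (hx : 1 ≤ x) :
    Real.logb σ x ≤ Real.logb 2 x := by
  have h2 : (2 : ℝ) ≤ σ := by exact_mod_cast hσ
  have h3 : 0 < Real.log 2 := Real.log_pos (by norm_num)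
  exact div_le_div_of_nonneg_left (Real.log_nonneg hx) h3
    (Real.log_le_log (by norm_num) h2)

theorem one_le_logb_nat {σ : ℕ} (hσ : 2 ≤ σ) {x : ℝ} (hx : σ ≤ x) : 1 ≤ Real.logb σ x := by
  have h2 : (2 : ℝ) ≤ σ := by exact_mod_cast hσ
  rw [Real.le_logb_iff_rpow_le (by linarith) (by linarith), Real.rpow_one]
  exact hx

theorem clog_lt_logb_add_one {σ N : ℕ} (hσ : 2 ≤ σ) (hN : 0 < N) :
    (Nat.clog σ N : ℝ) < Real.logb σ N + 1 := by
  rw [← Real.natCeil_logb_natCast]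
  refine Nat.ceil_lt_add_one (Real.logb_nonneg ?_ ?_)
  · exact_mod_cast hσ
  · exact_mod_cast hN

/-! ### The parameters of the string -/

/-- The parameters of the hard string of length `n` with about `z` phrases. -/
theorem exists_parameters {n σ z : ℕ} (hσ : 2 ≤ σ) (hσz : σ ≤ z)
    (hz : (z : ℝ) ≤ n / Real.logb σ n) (hn : 1024 * σ < n) :
    ∃ N k G : ℕ, n = σ + N * (2 * k + 4) + G + 1 + N * (2 * k + 4) ∧ 0 < N ∧ N ≤ z ∧
      z ≤ 64 * N ∧ N ≤ σ ^ k ∧ k ≤ N ∧ 4 * k + 8 ≤ G ∧ n ≤ 2 * G ∧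
      ((2 * k + 4 : ℕ) : ℝ) ≤ 8 * Real.logb σ z := by
  have hσ' : (2 : ℝ) ≤ σ := by exact_mod_cast hσ
  have hσz' : (σ : ℝ) ≤ z := by exact_mod_cast hσz
  have hn' : 1024 * (σ : ℝ) < n := by exact_mod_cast hn
  set N := z / 64 + 1 with hNdef
  have hN : 0 < N := by omega
  have hNz : N ≤ z := by omega
  have hzN : z ≤ 64 * N := by omega
  have hNz64 : 64 * N ≤ z + 64 := by omega
  set k := Nat.clog σ N with hk
  have hNk : N ≤ σ ^ k := Nat.le_pow_clog (by omega) N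
  have hkN : k ≤ N := by
    refine Nat.clog_le_of_le_pow ?_
    exact (Nat.lt_two_pow_self (n := N)).le.trans (Nat.pow_le_pow_left hσ N)
  have hμ1 : 1 ≤ Real.logb σ z := one_le_logb_nat hσ hσz'
  have hlog_ge : 1 ≤ Real.logb σ n := one_le_logb_nat hσ (by linarith)
  have hzn : (z : ℝ) * Real.logb σ n ≤ n := by
    rwa [le_div_iff₀ (by linarith)] at hz
  have hzn' : (z : ℝ) ≤ n := by nlinarith
  have hlog_le : Real.logb σ z ≤ Real.logb σ n :=
    Real.logb_le_logb_of_le (by linarith) (by linarith) hzn'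
  have hkμ : (k : ℝ) ≤ Real.logb σ z + 1 := by
    have h1 := clog_lt_logb_add_one hσ hN
    have h2 : Real.logb σ N ≤ Real.logb σ z :=
      Real.logb_le_logb_of_le (by linarith) (by exact_mod_cast hN) (by exact_mod_cast hNz)
    linarith
  have hL : ((2 * k + 4 : ℕ) : ℝ) ≤ 8 * Real.logb σ z := by push_cast; linarith
  have hlog : 128 * Real.logb σ n ≤ n := by
    have h1 := logb_nat_le_logb_two hσ (x := n) (by linarith)
    have h2 := mul_logb_two_le (x := n) (by linarith)
    linarith
  have hNL : (N : ℝ) * ((2 * k + 4 : ℕ) : ℝ) ≤ 3 / 16 * n := by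
    have h1 : 64 * (N : ℝ) ≤ z + 64 := by exact_mod_cast hNz64
    have h2 : ((2 * k + 4 : ℕ) : ℝ) ≤ 8 * Real.logb σ n := by linarith
    calc (N : ℝ) * ((2 * k + 4 : ℕ) : ℝ) ≤ ((z + 64) / 64) * (8 * Real.logb σ n) := by
          refine mul_le_mul (by linarith) h2 (by positivity) (by positivity)
      _ = (z * Real.logb σ n) / 8 + 8 * Real.logb σ n := by ring
      -- The first term is at most n/8 by the hypothesis on z, the second at most n/16 by `hlog`.
      _ ≤ 3 / 16 * n := by linarith
  have hNL' : 16 * (N * (2 * k + 4)) ≤ 3 * n := by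
    have : 16 * ((N : ℝ) * ((2 * k + 4 : ℕ) : ℝ)) ≤ 3 * n := by linarith
    exact_mod_cast this
  have hLN : 1 * (2 * k + 4) ≤ N * (2 * k + 4) := Nat.mul_le_mul_right _ hN
  exact ⟨N, k, n - (σ + 1 + 2 * (N * (2 * k + 4))), by omega, hN, hNz, hzN, hNk, hkN, by omega,
    by omega, hL⟩

/-! ### The ratio -/

/-- A string whose greedy parsing is close to `z` phrases and far from optimal. -/
theorem exists_string {ed el ec : ℕ → List Bool} (hed : IsLogEncoder ed) (hel : IsLogEncoder el)
    (hec : IsLogEncoder ec) :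
    ∃ c : ℝ, 0 < c ∧
      ∀ n σ z : ℕ, 1 < n → 2 ≤ σ → σ ≤ n → σ ≤ z → (z : ℝ) ≤ n / Real.logb σ n →
        ∃ (s : List ℕ) (P : List (List ℕ)) (gr opt : ℕ),
          IsString n σ s ∧ IsGreedyParsing s P ∧
          1 / 1024 * (z : ℝ) ≤ P.length ∧ (P.length : ℝ) ≤ 1024 * z ∧
          IsLeast (greedySizes ed el ec s) gr ∧ IsLeast (allSizes ed el ec s) opt ∧
          1 ≤ (gr : ℝ) / opt ∧
          c * min (z : ℝ) (Real.logb 2 n / (Real.logb 2 (Real.logb σ z) + Real.logb 2 σ)) ≤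
            (gr : ℝ) / opt := by
  obtain ⟨Kd, hKd0, hKd⟩ := hed.exists_le
  obtain ⟨Kl, hKl0, hKl⟩ := hel.exists_le
  obtain ⟨Kc, hKc0, hKc⟩ := hec.exists_le
  obtain ⟨a, b, ha, -, hda⟩ := hed
  set K := Kd + Kl + Kc with hK
  have hK0 : 0 < K := by positivity
  -- 46080 = 128 · 360 combines the bounds on greedy and optimal sizes; 1/11 serves the case n ≤
  -- 1024σ.
  refine ⟨min (a / (46080 * K)) (1 / 11), by positivity, ?_⟩
  intro n σ z hn hσ hσn hσz hz
  have hσ' : (2 : ℝ) ≤ σ := by exact_mod_cast hσ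
  have hσz' : (σ : ℝ) ≤ z := by exact_mod_cast hσz
  have hσn' : (σ : ℝ) ≤ n := by exact_mod_cast hσn
  have hμ1 : 1 ≤ Real.logb σ z := one_le_logb_nat hσ hσz'
  have hlog_ge : 1 ≤ Real.logb σ n := one_le_logb_nat hσ hσn'
  have hzn' : (z : ℝ) ≤ n := by
    rw [le_div_iff₀ (by linarith)] at hz; nlinarith
  have hzn : z ≤ n := by exact_mod_cast hzn'
  have hlμ : 0 ≤ Real.logb 2 (Real.logb σ z) := Real.logb_nonneg (by norm_num) hμ1
  have hlσ : 1 ≤ Real.logb 2 σ := one_le_logb_two hσ'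
  have hln : 1 ≤ Real.logb 2 n := one_le_logb_two (by linarith)
  set A := Real.logb 2 (Real.logb σ z) + Real.logb 2 σ with hA
  have hA1 : 1 ≤ A := by linarith
  have hmin0 : 0 ≤ min (z : ℝ) (Real.logb 2 n / A) := by positivity
  have ratio_ge_one : ∀ (s : List ℕ) (gr opt : ℕ), s.length = n →
      IsLeast (allSizes ed el ec s) opt → opt ≤ gr → 0 < opt ∧ 1 ≤ (gr : ℝ) / opt := by
    intro s gr opt hs hopt hle
    obtain ⟨P, w, h1, h2, rfl⟩ := hopt.1
    have h3 := length_encoding_pos hel (by omega) h1 h2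
    refine ⟨h3, ?_⟩
    rw [one_le_div (by exact_mod_cast h3)]
    exact_mod_cast hle
  -- In this case log n ≤ 10 + log σ ≤ 11A, so ratio 1 suffices, and σ ≤ z' ≤ n with σ ≤ z ≤ n makes
  -- z' proportional to z.
  by_cases hbig : n ≤ 1024 * σ
  · obtain ⟨P, w, hP, -⟩ := exists_greedy ed el ec (easyWord n σ)
    obtain ⟨gr, opt, hgr, hopt, hle⟩ := exists_isLeast_sizes ed el ec (easyWord n σ)
    obtain ⟨-, h1⟩ := ratio_ge_one _ gr opt (length_word _ _) hopt hle
    have h2 := le_length_greedy_easyWord hσn hP.1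
    have h3 := hP.1.length_le_length
    rw [easyWord, length_word] at h3
    refine ⟨easyWord n σ, P, gr, opt, isString_easyWord (by omega) hσn, hP, ?_, ?_, hgr, hopt,
      h1, ?_⟩
    · have : z ≤ 1024 * P.length := by omega
      have : (z : ℝ) ≤ 1024 * P.length := by exact_mod_cast this
      linarith
    · have : P.length ≤ 1024 * z := by omega
      exact_mod_cast this
    · have hbig' : (n : ℝ) ≤ 2 ^ 10 * σ := by norm_num; exact_mod_cast hbig
      have h4 : Real.logb 2 n ≤ 10 + Real.logb 2 σ := by
        have := Real.logb_le_logb_of_le (b := 2) (by norm_num) (by linarith) hbig'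
        rwa [Real.logb_mul (by norm_num) (by linarith), logb_two_pow] at this
      have h5 : Real.logb 2 n / A ≤ 11 := by
        rw [div_le_iff₀ (by linarith)]; linarith
      have h6 : min (z : ℝ) (Real.logb 2 n / A) ≤ 11 := (min_le_right _ _).trans h5
      calc _ ≤ 1 / 11 * (11 : ℝ) :=
            mul_le_mul (min_le_right _ _) h6 hmin0 (by norm_num)
        _ ≤ _ := by linarith
  · obtain ⟨N, k, G, hnG, hN, hNz, hzN, hNk, hkN, hG, hnG2, hL⟩ :=
      exists_parameters hσ hσz hz (by omega)
    have hlen : (hardWord σ k N G).length = n := by rw [length_hardWord, hnG]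
    have hn2048 : (2048 : ℝ) ≤ n := by
      have : 2048 ≤ n := by omega
      exact_mod_cast this
    obtain ⟨P, w, hP, -⟩ := exists_greedy ed el ec (hardWord σ k N G)
    obtain ⟨gr, opt, hgr, hopt, hle⟩ := exists_isLeast_sizes ed el ec (hardWord σ k N G)
    obtain ⟨hpos, h1⟩ := ratio_ge_one _ gr opt hlen hopt hle
    have h2 := le_length_greedy hσ hG hNk hP
    -- the cost of the cheap phrases
    have hLlog : Real.logb 2 (((2 * k + 4 : ℕ) : ℝ) + 1) ≤
        4 + Real.logb 2 (Real.logb σ z) := by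
      have : ((2 * k + 4 : ℕ) : ℝ) + 1 ≤ 2 ^ 4 * Real.logb σ z := by linarith
      have := Real.logb_le_logb_of_le (b := 2) (by norm_num) (by positivity) this
      rwa [Real.logb_mul (by norm_num) (by linarith), logb_two_pow] at this
    have hLlog0 : 0 ≤ Real.logb 2 (((2 * k + 4 : ℕ) : ℝ) + 1) :=
      Real.logb_nonneg (by norm_num) (by linarith [Nat.cast_nonneg (α := ℝ) (2 * k + 4)])
    have hσlog := logb_two_add_one_le hσ'
    have hcheap : CheapTriples ed el ec (2 * k + 4) σ ⌊10 * K * A⌋₊ := by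
      intro d l c hd hl hl' hc
      refine Nat.le_floor ?_
      have e1 := hKd d (2 * k + 4) hd.le (by omega)
      have e2 := hKl l (2 * k + 4) hl' (by omega)
      have e3 := hKc c σ hc.le (by omega)
      have e4 : Kd * Real.logb 2 (((2 * k + 4 : ℕ) : ℝ) + 1) ≤ Kd * (5 * A) :=
        mul_le_mul_of_nonneg_left (by linarith) hKd0.le
      have e5 : Kl * Real.logb 2 (((2 * k + 4 : ℕ) : ℝ) + 1) ≤ Kl * (5 * A) :=
        mul_le_mul_of_nonneg_left (by linarith) hKl0.le
      have e6 : Kc * Real.logb 2 ((σ : ℝ) + 1) ≤ Kc * (5 * A) :=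
        mul_le_mul_of_nonneg_left (by linarith) hKc0.le
      have e7 : 0 ≤ K * A := by positivity
      have e8 : K * A = Kd * A + Kl * A + Kc * A := by rw [hK]; ring
      simp only [bits]
      push_cast
      linarith
    -- the cost of the long phrase
    have hlong : ((bits ed el ec ⟨0, G, 0⟩ : ℕ) : ℝ) ≤ 4 * K * Real.logb 2 n := by
      have e1 := hKd 0 n (by omega) (by omega)
      have e2 := hKl G n (by omega) (by omega)
      have e3 := hKc 0 n (by omega) (by omega)
      have e4 := logb_two_add_one_le (x := n) (by linarith)
      have e5 : K * Real.logb 2 ((n : ℝ) + 1) ≤ K * (2 * Real.logb 2 n) :=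
        mul_le_mul_of_nonneg_left e4 hK0.le
      have e6 : 0 ≤ K * Real.logb 2 n := by positivity
      have e8 : K * Real.logb 2 ((n : ℝ) + 1) = Kd * Real.logb 2 ((n : ℝ) + 1) +
        Kl * Real.logb 2 ((n : ℝ) + 1) + Kc * Real.logb 2 ((n : ℝ) + 1) := by rw [hK]; ring
      simp only [bits]
      push_cast
      linarith
    obtain ⟨Q, hQ, hQlen, w', hw', hw'len⟩ :=
      (parsable_hardWord (G := G) hσ hN (by omega) hcheap le_rfl).exists_parsing
    have h3 := hP.length_le hQ
    have h4 : opt ≤ w'.length := hopt.2 ⟨Q, w', hQ, hw', rfl⟩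
    have hopt_le : (opt : ℝ) ≤ 180 * K * (z * A + Real.logb 2 n) := by
      have e1 : (opt : ℝ) ≤ (((σ + 2 * (2 * N + (2 * k + 4)) + 1) * ⌊10 * K * A⌋₊ +
        bits ed el ec ⟨0, G, 0⟩ : ℕ) : ℝ) := by exact_mod_cast h4.trans hw'len
      -- σ, N and k are at most z, so the left side is at most 9z + 9.
      have e2 : ((σ + 2 * (2 * N + (2 * k + 4)) + 1 : ℕ) : ℝ) ≤ 18 * z := by
        have : σ + 2 * (2 * N + (2 * k + 4)) + 1 ≤ 18 * z := by omega
        exact_mod_cast this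
      have e3 : ((⌊10 * K * A⌋₊ : ℕ) : ℝ) ≤ 10 * K * A := Nat.floor_le (by positivity)
      have e4 : ((σ + 2 * (2 * N + (2 * k + 4)) + 1 : ℕ) : ℝ) * (⌊10 * K * A⌋₊ : ℕ) ≤
          18 * z * (10 * K * A) := mul_le_mul e2 e3 (by positivity) (by positivity)
      rw [Nat.cast_add, Nat.cast_mul] at e1
      have e5 : 0 ≤ K * Real.logb 2 n := by positivity
      linarith
    have hgr_ge : a / 128 * (z * Real.logb 2 n) ≤ gr := by
      obtain ⟨P', w'', hP', hw'', hlen''⟩ := hgr.1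
      -- For d ≥ G ≥ n/2, log (d + 1) ≥ log n − 1 ≥ (log n)/2.
      have e1 := le_length_greedy_encoding hσ hG hNk hP' hw'' (B := a / 2 * Real.logb 2 n) ?_
      · rw [hlen''] at e1
        have e2 : (z : ℝ) ≤ 64 * N := by exact_mod_cast hzN
        have e3 : (z : ℝ) * (a * Real.logb 2 n) ≤ 64 * N * (a * Real.logb 2 n) :=
          mul_le_mul_of_nonneg_right e2 (by positivity)
        linarith
      · intro d hd
        refine le_trans ?_ (hda d (by omega)).1
        have e1 : (n : ℝ) ≤ 2 * d := by
          have : n ≤ 2 * d := by omega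
          exact_mod_cast this
        have e2 : Real.logb 2 n ≤ 1 + Real.logb 2 (d + 1) := by
          have := Real.logb_le_logb_of_le (b := 2) (x := n) (y := 2 * ((d : ℝ) + 1))
            (by norm_num) (by linarith) (by linarith)
          rwa [Real.logb_mul (by norm_num) (by positivity),
            Real.logb_self_eq_one (by norm_num)] at this
        have e3 : 2 ≤ Real.logb 2 n := by
          have := Real.logb_le_logb_of_le (b := 2) (x := 2 ^ 2) (y := n)
            (by norm_num) (by norm_num) (by linarith)
          rw [logb_two_pow] at this
          exact_mod_cast this
        have e4 : a / 2 * Real.logb 2 n ≤ a / 2 * (2 * Real.logb 2 (d + 1)) :=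
          mul_le_mul_of_nonneg_left (by linarith) (by positivity)
        linarith
    refine ⟨hardWord σ k N G, P, gr, opt, ?_, hP, ?_, ?_, hgr, hopt, h1, ?_⟩
    · have := isString_hardWord (σ := σ) (k := k) (N := N) (G := G) hσ
      rwa [← hnG] at this
    · have : z ≤ 1024 * P.length := by omega
      have : (z : ℝ) ≤ 1024 * P.length := by exact_mod_cast this
      linarith
    · have : P.length ≤ 1024 * z := by omega
      exact_mod_cast this
    · rw [le_div_iff₀ (by exact_mod_cast hpos)]
      set m := min (z : ℝ) (Real.logb 2 n / A) with hm
      -- Each term of zA + log n, multiplied by the minimum m, is at most z log n; the two entries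
      -- of the minimum serve one term each.
      have e1 : m * (z * A) ≤ z * Real.logb 2 n := by
        have : m * A ≤ Real.logb 2 n := by
          rw [← le_div_iff₀ (by linarith)]; exact min_le_right _ _
        calc m * (z * A) = z * (m * A) := by ring
          _ ≤ _ := mul_le_mul_of_nonneg_left this (by positivity)
      have e2 : m * Real.logb 2 n ≤ z * Real.logb 2 n :=
        mul_le_mul_of_nonneg_right (min_le_left _ _) (by linarith)
      have e3 : m * opt ≤ 360 * K * (z * Real.logb 2 n) := by
        calc m * opt ≤ m * (180 * K * (z * A + Real.logb 2 n)) :=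
              mul_le_mul_of_nonneg_left hopt_le hmin0
          _ = 180 * K * (m * (z * A) + m * Real.logb 2 n) := by ring
          _ ≤ 180 * K * (z * Real.logb 2 n + z * Real.logb 2 n) :=
              mul_le_mul_of_nonneg_left (by linarith) (by positivity)
          _ = _ := by ring
      calc min (a / (46080 * K)) (1 / 11) * m * opt
          = min (a / (46080 * K)) (1 / 11) * (m * opt) := by ring
        _ ≤ a / (46080 * K) * (360 * K * (z * Real.logb 2 n)) :=
            mul_le_mul (min_le_left _ _) e3 (by positivity) (by positivity)
        _ = a / 128 * (z * Real.logb 2 n) := by field_simp; ring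
        _ ≤ gr := hgr_ge

theorem upperBound_le (n σ z : ℕ) : upperBound n σ z ≤ z := by
  unfold upperBound
  split_ifs
  · exact min_le_left _ _
  · exact le_rfl

/-- For a number `z'` of phrases proportional to `z`, the upper bound in terms of `z'` is at most
a constant multiple of the lower bound in terms of `z`. -/
theorem upperBound_le_min {n σ z z' : ℕ} (hn : 1 ≤ n) (hσ : 2 ≤ σ) (hz : σ ≤ z)
    (hz' : σ ^ 2 ≤ z') (h1 : 1 / 1024 * (z : ℝ) ≤ z') (h2 : (z' : ℝ) ≤ 1024 * z) :
    upperBound n σ z' ≤ 1024 * (4 + Real.logb 2 σ) *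
      min (z : ℝ) (Real.logb 2 n / (Real.logb 2 (Real.logb σ z) + Real.logb 2 σ)) := by
  have hσ' : (2 : ℝ) ≤ σ := by exact_mod_cast hσ
  have hzr : (σ : ℝ) ≤ z := by exact_mod_cast hz
  have hz'r : (σ : ℝ) ^ 2 ≤ z' := by exact_mod_cast hz'
  have hlσ : 1 ≤ Real.logb 2 σ := one_le_logb_two hσ'
  have hln : 0 ≤ Real.logb 2 n := Real.logb_nonneg (by norm_num) (by exact_mod_cast hn)
  have hz'pos : (0 : ℝ) < z' := by nlinarith
  have h3 : 2 ≤ Real.logb σ z' := by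
    have := Real.logb_le_logb_of_le (b := σ) (by linarith) (by positivity) hz'r
    rw [Real.logb_pow, Real.logb_self_eq_one (by linarith)] at this
    simpa using this
  -- log_σ z ≤ 10 + log_σ z', and 10 ≤ 7 log_σ z' because z' ≥ σ².
  have h4 : Real.logb σ z ≤ 2 ^ 3 * Real.logb σ z' := by
    have e1 := Real.logb_le_logb_of_le (b := σ) (x := z) (y := 2 ^ 10 * (z' : ℝ))
      (by linarith) (by linarith) (by norm_num; linarith)
    have e2 := logb_nat_le_logb_two hσ (x := 2 ^ 10) (by norm_num)
    rw [logb_two_pow] at e2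
    rw [Real.logb_mul (by norm_num) hz'pos.ne'] at e1
    norm_num at e1 e2 ⊢
    linarith
  have h5 : 1 ≤ Real.logb σ z := one_le_logb_nat hσ hzr
  have h6 : 1 ≤ Real.logb 2 (Real.logb σ z') := one_le_logb_two h3
  have h7 : Real.logb 2 (Real.logb σ z) ≤ 3 + Real.logb 2 (Real.logb σ z') := by
    have := Real.logb_le_logb_of_le (b := 2) (by norm_num) (by linarith) h4
    rwa [Real.logb_mul (by norm_num) (by linarith), logb_two_pow] at this
  have h8 : 0 ≤ Real.logb 2 (Real.logb σ z) := Real.logb_nonneg (by norm_num) h5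
  rw [upperBound, if_pos (by linarith), mul_min_of_nonneg _ _ (by positivity)]
  refine min_le_min ?_ ?_
  · nlinarith
  · rw [← mul_div_assoc, div_le_div_iff₀ (by linarith) (by linarith)]
    -- The left side is at most 3 + log σ + log log_σ z', and log log_σ z' ≥ 1 turns the sum into a
    -- multiple.
    have e1 : Real.logb 2 (Real.logb σ z) + Real.logb 2 σ ≤
        1024 * (4 + Real.logb 2 σ) * Real.logb 2 (Real.logb σ z') := by nlinarith
    calc _ ≤ Real.logb 2 n * (1024 * (4 + Real.logb 2 σ) * Real.logb 2 (Real.logb σ z')) :=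
          mul_le_mul_of_nonneg_left e1 hln
      _ = _ := by ring

end LZ77

/-! ### The two parts of the theorem -/

theorem theorem2 :
    ∃ a b : ℝ, 0 < a ∧ 0 < b ∧
      ∀ ed el ec : ℕ → List Bool,
        LZ77.IsLogEncoder ed → LZ77.IsLogEncoder el → LZ77.IsLogEncoder ec →
        (∃ c : ℝ, 0 < c ∧
          ∀ n σ z : ℕ, 1 < n → 2 ≤ σ → σ ≤ n → σ ≤ z → (z : ℝ) ≤ n / Real.logb σ n →
            ∃ (s : List ℕ) (P : List (List ℕ)) (gr opt : ℕ),
              LZ77.IsString n σ s ∧ LZ77.IsGreedyParsing s P ∧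
              a * z ≤ P.length ∧ P.length ≤ b * z ∧
              IsLeast (LZ77.greedySizes ed el ec s) gr ∧
              IsLeast (LZ77.allSizes ed el ec s) opt ∧
              c * min (z : ℝ)
                  (Real.logb 2 n / (Real.logb 2 (Real.logb σ z) + Real.logb 2 σ)) ≤
                (gr : ℝ) / opt) ∧
        (∀ σ : ℕ, 2 ≤ σ → ∃ c : ℝ, 0 < c ∧
          ∀ n z : ℕ, 1 < n → σ ≤ n → σ ≤ z → (z : ℝ) ≤ n / Real.logb σ n →
            ∃ (s : List ℕ) (P : List (List ℕ)) (gr opt : ℕ),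
              LZ77.IsString n σ s ∧ LZ77.IsGreedyParsing s P ∧
              a * z ≤ P.length ∧ P.length ≤ b * z ∧
              IsLeast (LZ77.greedySizes ed el ec s) gr ∧
              IsLeast (LZ77.allSizes ed el ec s) opt ∧
              c * LZ77.upperBound n σ P.length ≤ (gr : ℝ) / opt) := by
  refine ⟨1 / 1024, 1024, by norm_num, by norm_num, fun ed el ec hed hel hec => ?_⟩
  obtain ⟨c, hc, h⟩ := LZ77.exists_string hed hel hec
  constructor
  · refine ⟨c, hc, fun n σ z hn hσ hσn hσz hz => ?_⟩
    obtain ⟨s, P, gr, opt, h1, h2, h3, h4, h5, h6, -, h7⟩ := h n σ z hn hσ hσn hσz hz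
    exact ⟨s, P, gr, opt, h1, h2, h3, h4, h5, h6, h7⟩
  · intro σ hσ
    have hσ' : (2 : ℝ) ≤ σ := by exact_mod_cast hσ
    have hlσ : 1 ≤ Real.logb 2 σ := LZ77.one_le_logb_two hσ'
    have hD : 0 < 1024 * (4 + Real.logb 2 (σ : ℝ)) := by linarith
    refine ⟨min (c / (1024 * (4 + Real.logb 2 σ))) (1 / (σ : ℝ) ^ 2), by positivity, ?_⟩
    intro n z hn hσn hσz hz
    obtain ⟨s, P, gr, opt, h1, h2, h3, h4, h5, h6, h7, h8⟩ := h n σ z hn hσ hσn hσz hz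
    refine ⟨s, P, gr, opt, h1, h2, h3, h4, h5, h6, ?_⟩
    have hC : 0 < min (c / (1024 * (4 + Real.logb 2 σ))) (1 / (σ : ℝ) ^ 2) := by positivity
    -- For z' ≤ σ² the denominator log log_σ z' may be tiny or vanish; the upper bound is then at
    -- most σ² and ratio 1 suffices.
    rcases le_total (σ ^ 2) P.length with hle | hle
    · refine le_trans ?_ h8
      have h9 := LZ77.upperBound_le_min hn.le hσ hσz hle h3 h4
      set m := min (z : ℝ) (Real.logb 2 n / (Real.logb 2 (Real.logb σ z) + Real.logb 2 σ))
      have hm : 0 ≤ m := by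
        have e1 := LZ77.one_le_logb_nat hσ (x := z) (by exact_mod_cast hσz)
        have e2 := Real.logb_nonneg (b := 2) (by norm_num) e1
        have e3 : 0 ≤ Real.logb 2 (n : ℝ) :=
          Real.logb_nonneg (by norm_num) (by exact_mod_cast hn.le)
        exact le_min (by positivity) (div_nonneg e3 (by linarith))
      calc _ ≤ min (c / (1024 * (4 + Real.logb 2 σ))) (1 / (σ : ℝ) ^ 2) *
            (1024 * (4 + Real.logb 2 σ) * m) := mul_le_mul_of_nonneg_left h9 hC.le
        _ ≤ c / (1024 * (4 + Real.logb 2 σ)) * (1024 * (4 + Real.logb 2 σ) * m) :=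
            mul_le_mul_of_nonneg_right (min_le_left _ _) (by positivity)
        _ = c * m := by rw [← mul_assoc, div_mul_cancel₀ _ hD.ne']
    · refine le_trans ?_ h7
      have h9 : LZ77.upperBound n σ P.length ≤ (σ : ℝ) ^ 2 :=
        (LZ77.upperBound_le _ _ _).trans (by exact_mod_cast hle)
      calc _ ≤ min (c / (1024 * (4 + Real.logb 2 σ))) (1 / (σ : ℝ) ^ 2) * (σ : ℝ) ^ 2 :=
            mul_le_mul_of_nonneg_left h9 hC.le
        _ ≤ 1 / (σ : ℝ) ^ 2 * (σ : ℝ) ^ 2 :=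
            mul_le_mul_of_nonneg_right (min_le_right _ _) (by positivity)
        _ = 1 := by rw [one_div, inv_mul_cancel₀ (by positivity)]
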